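/- **Setting.** $m\ge1$ nodes hold $n\ge 1$ samples each, $\bm S=(\xi_{i,k})$, all independent, those of node $i$ drawn from $\mathcal D_i$. The loss $f(\cdot;\xi):\mathbb R^d\to\mathbb R$ is, for every $\xi$, convex, differentiable, $G$-Lipschitz and $L$-smooth ($G\ge0$, $L>0$), and integrable in $\xi$; $F(w)=\frac1m\sum_i\mathbb E_{\xi\sim\mathcal D_i}f(w;\xi)$. The matrix $P\in\mathbb R^{m\times m}$ is nonnegative, column-stochastic and primitive; $\pi>0$ is its stationary distribution ($P\pi=\pi$, $\sum_i\pi_i=1$) and $\delta=\min_i\pi_i$. Its SLEM is $\max\{|\mu|:\mu\in\sigma(P),\mu\ne1\}$ ($0$ if there is no such $\mu$). We say that $C$ is a mixing constant at rate $\lambda$ if $\max_i\sum_j|(P^t)_{ij}-\pi_i|\le C\lambda^t$ for all $t\ge0$. Stochastic Gradient Push (SGP): given $w_i^{(0)}$ and $u_i^{(0)}=1$, put $z_i^{(t)}=w_i^{(t)}/u_i^{(t)}$, $w_i^{(t+1)}=\sum_jP_{ij}\big(w_j^{(t)}-\gamma_t\nabla f(z_j^{(t)};\xi_j^{(t)})\big)$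 and $u_i^{(t+1)}=\sum_jP_{ij}u_j^{(t)}$. In each round $\xi_j^{(t)}$ is a uniformly chosen sample of node $j$; the choices are independent over the rounds and of the data, and arbitrarily dependent across the nodes (for instance independent indices, or one index shared by all nodes). Let $\overline w^{(t)}=\frac1m\sum_iw_i^{(t)}$, assume $\frac1m\sum_i\|w_i^{(0)}\|\le C_{w_0}$, and let the parameter space be bounded: almost surely $\|\overline w^{(t)}\|\le r$ for all $t$, and $w^*$ with $\|w^*\|\le r$ minimizes $F$ on the closed ball of radius $r>0$. The output is $w_{\rm avg}^{(T)}=\sum_t\gamma_t\overline w^{(t)}/\sum_t\gamma_t$, where $t$ runs over $0,\dots,T-1$ or over $1,\dots,T$ (the statement holds for both), and $\epsilon_{\rm exc}(T)=\mathbb E\big[F(w_{\rm avg}^{(T)})-F(w^*)\big]$. **Statement.** (0) Every such $P$ has exactly one $\pi$ as above and its SLEM lies in $[0,1)$; each $\lambda\in(\mathrm{SLEM},1)$ admits a mixing constant, and so does $\lambda=\mathrm{SLEM}$ if $P$ is diagonalizable over $\mathbb C$. For all $G,L,r,C_{w_0},C$ there is $K>0$ depending only on these five numbers such that for all $m,n$,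 all $P$, and every $\lambda\in[0,1)$ at which $C$ is a mixing constant of $P$, the following holds, where $\Theta$ hides only factors in $[1/K,K]$. (1) Constant step sizes $\gamma_t=\gamma$, $0<\gamma\le2/L$. There is an integer $T^\star\ge1$ with $$T^\star=\Theta\Big(\frac{\sqrt{mn}}{\gamma}\sqrt{\frac{\delta(1-\lambda)+\gamma}{\delta(1-\lambda)+mn\gamma}}\Big)$$ (and, when $\gamma\le\delta(1-\lambda)$, also $T^\star=\Theta\big(\frac1\gamma\sqrt{mn/(1+\frac{mn\gamma}{\delta(1-\lambda)})}\big)$), such that for all $d$, sample spaces, $f$, $\mathcal D_i$, index laws, initial points and $w^*$ as above, $F(w_{\rm avg}^{(T^\star)})$ is integrable and $$\epsilon_{\rm exc}(T^\star)\le K\Big(\frac1{\sqrt{mn}}+\sqrt{\frac{\gamma}{\delta(1-\lambda)}}+\frac{\gamma}{\delta(1-\lambda)}+\gamma\Big).$$ (2) Diminishing step sizes $\gamma_t=\frac v{t+1}$, $0<v\le2/L$. There is an integer $T^\star\ge1$ with $$T^\star=\Theta\Big(\exp\Big(\frac{\sqrt{mn}}v\sqrt{1+\frac{v^2}{\delta(1-\lambda)}}\Big)\Big)$$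 such that, for the same objects as in (1), $F(w_{\rm avg}^{(T^\star)})$ is integrable and $$\epsilon_{\rm exc}(T^\star)\le K\Big(\frac1{\sqrt{mn}}+\frac v{\delta(1-\lambda)}+\frac v{\sqrt{mn\,\delta(1-\lambda)}}+v^2\Big).$$ -/

import Mathlib

open MeasureTheory Matrix

universe u

noncomputable section

/-! ### Communication matrix -/

/-- `π` is the stationary (Perron) distribution of `P`: positive, of total mass one, `P π = π`. -/
structure IsPerronVector {m : ℕ} (P : Matrix (Fin m) (Fin m) ℝ) (π : Fin m → ℝ) : Prop where
  pos : ∀ i, 0 < π i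
  sum_eq_one : ∑ i, π i = 1
  fixed : P *ᵥ π = π

/-- Second largest eigenvalue modulus: the maximum of `|μ|` over the complex eigenvalues `μ ≠ 1`
of `P` (the value is `0` if there is no such eigenvalue). -/
def slem {m : ℕ} (P : Matrix (Fin m) (Fin m) ℝ) : ℝ :=
  sSup {x : ℝ | ∃ μ ∈ spectrum ℂ (P.map Complex.ofReal), μ ≠ 1 ∧ x = ‖μ‖}

/-- `P` is diagonalizable over `ℂ`. -/
def IsDiagonalizable {m : ℕ} (P : Matrix (Fin m) (Fin m) ℝ) : Prop :=
  ∃ (V : Matrix (Fin m) (Fin m) ℂ) (e : Fin m → ℂ),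
    IsUnit V.det ∧ P.map Complex.ofReal = V * Matrix.diagonal e * V⁻¹

/-- `C` is a mixing constant of `P` at rate `lam`: in the norm induced by the sup norm (maximal
absolute row sum), `‖P ^ t - π 1ᵀ‖ ≤ C * lam ^ t` for every `t ≥ 0`. -/
def IsMixingConstant {m : ℕ} (P : Matrix (Fin m) (Fin m) ℝ) (π : Fin m → ℝ) (lam C : ℝ) : Prop :=
  ∀ (t : ℕ) (i : Fin m), ∑ j, |(P ^ t) i j - π i| ≤ C * lam ^ t

/-- `δ (1 - λ)`, where `δ = min_i π_i` is the topological imbalance parameter. -/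
def topoFactor {m : ℕ} (π : Fin m → ℝ) (lam : ℝ) : ℝ := (⨅ i, π i) * (1 - lam)

/-! ### Stochastic Gradient Push -/

section SGP

variable {m n d : ℕ} {Z : Type u}

/-- Push-sum weights `u^(t)`: `u^(0) = 1`, `u^(t+1) = P u^(t)`. -/
def pushWeight (P : Matrix (Fin m) (Fin m) ℝ) : ℕ → Fin m → ℝ
  | 0 => fun _ => 1
  | t + 1 => P *ᵥ pushWeight P t

/-- The proxies `w_i^(t)` of SGP on the data set `S` (node `i` holds `S i 0, …, S i (n-1)`), when
node `i` uses its sample number `ω t i` in round `t`: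
`w_i^(t+1) = ∑_j P_ij (w_j^(t) - γ_t ∇f(z_j^(t); ξ_j^(t)))` with `z_j^(t) = w_j^(t) / u_j^(t)`. -/
def sgpProxy (P : Matrix (Fin m) (Fin m) ℝ) (gamma : ℕ → ℝ)
    (f : EuclideanSpace ℝ (Fin d) → Z → ℝ) (w0 : Fin m → EuclideanSpace ℝ (Fin d))
    (S : Fin m → Fin n → Z) (ω : ℕ → Fin m → Fin n) : ℕ → Fin m → EuclideanSpace ℝ (Fin d)
  | 0 => w0
  | t + 1 => fun i => ∑ j, P i j •
      (sgpProxy P gamma f w0 S ω t j - gamma t •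
        gradient (fun x => f x (S j (ω t j)))
          ((pushWeight P t j)⁻¹ • sgpProxy P gamma f w0 S ω t j))

/-- The consensus model: the average over the nodes of the proxies. -/
def sgpMean (P : Matrix (Fin m) (Fin m) ℝ) (gamma : ℕ → ℝ)
    (f : EuclideanSpace ℝ (Fin d) → Z → ℝ) (w0 : Fin m → EuclideanSpace ℝ (Fin d))
    (S : Fin m → Fin n → Z) (ω : ℕ → Fin m → Fin n) (t : ℕ) : EuclideanSpace ℝ (Fin d) :=
  (m : ℝ)⁻¹ • ∑ i, sgpProxy P gamma f w0 S ω t i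

/-- The output: the step-size weighted average of the `T` consensus models of the rounds
`s, …, s + T - 1`. -/
def sgpOutput (P : Matrix (Fin m) (Fin m) ℝ) (gamma : ℕ → ℝ)
    (f : EuclideanSpace ℝ (Fin d) → Z → ℝ) (w0 : Fin m → EuclideanSpace ℝ (Fin d))
    (s T : ℕ) (S : Fin m → Fin n → Z) (ω : ℕ → Fin m → Fin n) : EuclideanSpace ℝ (Fin d) :=
  (∑ t ∈ Finset.Ico s (s + T), gamma t)⁻¹ •
    ∑ t ∈ Finset.Ico s (s + T), gamma t • sgpMean P gamma f w0 S ω t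

/-! ### Risk, and the standing assumptions -/

/-- The population risk `F(w) = (1/m) ∑_i E_{ξ ∼ D_i} f(w; ξ)`. -/
def popRisk [MeasurableSpace Z] (f : EuclideanSpace ℝ (Fin d) → Z → ℝ) (D : Fin m → Measure Z)
    (w : EuclideanSpace ℝ (Fin d)) : ℝ :=
  (m : ℝ)⁻¹ * ∑ i, ∫ ξ, f w ξ ∂(D i)

/-- Joint law of the data set (all samples independent, those of node `i` with law `D i`) and of
the sample indices (independent of the data, i.i.d. over the rounds, with law `ν` in each round). -/
def runLaw [MeasurableSpace Z] (n : ℕ) (D : Fin m → Measure Z) (ν : Measure (Fin m → Fin n)) :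
    Measure ((Fin m → Fin n → Z) × (ℕ → Fin m → Fin n)) :=
  (Measure.pi fun i => Measure.pi fun _ : Fin n => D i).prod (Measure.infinitePi fun _ : ℕ => ν)

/-- The loss is convex, differentiable, `G`-Lipschitz and `L`-smooth in the parameter, for every
sample (and measurable in the sample). -/
structure IsConvexLoss [MeasurableSpace Z] (f : EuclideanSpace ℝ (Fin d) → Z → ℝ) (G L : ℝ) :
    Prop where
  measurable : ∀ w, Measurable (f w)
  convex : ∀ ξ, ConvexOn ℝ Set.univ (fun w => f w ξ)
  differentiable : ∀ ξ, Differentiable ℝ (fun w => f w ξ)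
  lipschitz : ∀ ξ x y, |f y ξ - f x ξ| ≤ G * ‖y - x‖
  smooth : ∀ ξ x y,
    ‖gradient (fun w => f w ξ) y - gradient (fun w => f w ξ) x‖ ≤ L * ‖y - x‖

/-- The assumptions on one run of SGP: a convex, `G`-Lipschitz, `L`-smooth loss with finite risks;
in each round every node uses a uniformly distributed index (jointly for all nodes in an arbitrary
way: independent indices, or one index shared by all nodes); `(1/m) ∑ ‖w_i^(0)‖ ≤ W`; bounded
parameter space: the consensus models stay in the closed ball of radius `r` around `0`, and `wstar`
minimizes the population risk on this ball. -/
structure IsSGPRun [MeasurableSpace Z] (G L r W : ℝ) (P : Matrix (Fin m) (Fin m) ℝ)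
    (gamma : ℕ → ℝ) (f : EuclideanSpace ℝ (Fin d) → Z → ℝ) (D : Fin m → Measure Z)
    (ν : Measure (Fin m → Fin n)) (w0 : Fin m → EuclideanSpace ℝ (Fin d))
    (wstar : EuclideanSpace ℝ (Fin d)) : Prop where
  loss : IsConvexLoss f G L
  integrable : ∀ w i, Integrable (f w) (D i)
  uniform : ∀ i k, ν {x | x i = k} = (n : ENNReal)⁻¹
  init : (m : ℝ)⁻¹ * ∑ i, ‖w0 i‖ ≤ W
  bounded : ∀ᵐ p ∂(runLaw n D ν), ∀ t, ‖sgpMean P gamma f w0 p.1 p.2 t‖ ≤ r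
  wstar_mem : ‖wstar‖ ≤ r
  wstar_min : ∀ w, ‖w‖ ≤ r → popRisk f D wstar ≤ popRisk f D w

/-- For every run of SGP with mixing matrix `P`, `n` samples per node and step sizes `gamma`, the
expected excess risk of the averaged output at time `T` exists and is at most `B`. The average may
start at round `0` or at round `1`. -/
def ExcessRiskAtMost (n : ℕ) (G L r W : ℝ) (P : Matrix (Fin m) (Fin m) ℝ) (gamma : ℕ → ℝ)
    (T : ℕ) (B : ℝ) : Prop :=
  ∀ (d : ℕ) (Z : Type u) [MeasurableSpace Z]
    (f : EuclideanSpace ℝ (Fin d) → Z → ℝ)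
    (D : Fin m → Measure Z) [∀ i, IsProbabilityMeasure (D i)]
    (ν : Measure (Fin m → Fin n)) [IsProbabilityMeasure ν]
    (w0 : Fin m → EuclideanSpace ℝ (Fin d)) (wstar : EuclideanSpace ℝ (Fin d)),
    IsSGPRun G L r W P gamma f D ν w0 wstar →
    ∀ s : ℕ, s ≤ 1 →
      Integrable (fun p => popRisk f D (sgpOutput P gamma f w0 s T p.1 p.2)) (runLaw n D ν) ∧
      ∫ p, (popRisk f D (sgpOutput P gamma f w0 s T p.1 p.2) - popRisk f D wstar)
        ∂(runLaw n D ν) ≤ B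

end SGP

end

noncomputable section

/-! ### Column-stochastic primitive matrices -/

section Perron

variable {m : ℕ} {P : Matrix (Fin m) (Fin m) ℝ}

/-! Spectral part. Some power `P ^ k` has all entries at least `ε > 0`; subtracting `ε` from every
entry does not change its action on vectors of total mass zero, so it contracts them in `ℓ¹`
(`exists_pow_contraction`). This yields uniqueness of the Perron vector and `slem P < 1`. The powers
of `P - π 1ᵀ` are `P ^ t - π 1ᵀ` for `t ≥ 1` and its spectral radius is at most `slem P`, so
Gelfand's formula gives mixing at every larger rate; for diagonalizable `P` the eigenvalue expansion
gives the rate `slem P` itself.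

Risk part. Write `κ = δ (1 - λ)`, `N = m n`, and let `B_t` be `consensusBound`. Averaging over the
nodes removes `P`, so the consensus model follows averaged gradient steps, except that the gradients
are taken at the de-biased iterates, at distance at most `B_t` (`norm_debiased_sub_mean_le`). Two
estimates follow.

Stability: a gradient step with `γ ≤ 2 / L` is nonexpansive by co-coercivity. After one sample is
replaced, two runs with the same indices therefore separate in round `t` by at most `γ_t (2 L B_t +
2 G / m)`, the last term only when the replaced sample is drawn, which has probability `1 / n`.
Exchanging the replaced sample with its fresh copy turns this into a bound of population risk by
empirical risk (`integral_loss_fresh_le`).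

Optimization: the squared distance to `w*` telescopes up to errors `G γ_t B_t` and `G² γ_t²`. The
index of round `t` is independent of the iterate of round `t`, so the expected sampled loss is the
expected empirical risk, and Jensen passes to the averaged output.

Since `∑ γ_t B_t` is of order `(γ_0 + ∑ γ_t²) / κ`, the excess risk is at most a constant times `(1
+ S2 + q) / S1 + q + S1 / N`, where `S1 = ∑ γ_t`, `S2 = ∑ γ_t²` and `q = (γ_0 + S2) / κ`
(`excessRiskAtMost_of_le`). The stopping times balance the decreasing and increasing terms. For
constant steps and `y = T γ`, `(1 + γ/κ) / y` is matched with `y (1/N + γ/κ)`, so `y² = N (κ + γ) /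
(κ + N γ)`. For `γ_t = v / (t + 1)`, `S1` is about `v log T` and `S2 ≤ 2 v²`; matching `(1 + v²/κ) /
(v log T)` with `v log T / N` gives the exponential time. -/

lemma sum_mulVec_of_colStochastic (hs : ∀ j, ∑ i, P i j = 1) (v : Fin m → ℝ) :
    ∑ i, (P *ᵥ v) i = ∑ j, v j := by
  simp only [Matrix.mulVec, dotProduct]
  rw [Finset.sum_comm]
  simp [← Finset.sum_mul, hs]

lemma colStochastic_pow (hs : ∀ j, ∑ i, P i j = 1) (t : ℕ) (j : Fin m) :
    ∑ i, (P ^ t) i j = 1 := by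
  induction t generalizing j with
  | zero => simp [Matrix.one_apply]
  | succ t ih =>
    simp only [pow_succ, Matrix.mul_apply]
    rw [Finset.sum_comm]
    simp [← Finset.sum_mul, ih, hs]

lemma pow_entry_nonneg (h0 : ∀ i j, 0 ≤ P i j) (t : ℕ) (i j : Fin m) : 0 ≤ (P ^ t) i j := by
  induction t generalizing i j with
  | zero => simp only [pow_zero, Matrix.one_apply]; split_ifs <;> norm_num
  | succ t ih =>
    rw [pow_succ, Matrix.mul_apply]
    exact Finset.sum_nonneg fun k _ => mul_nonneg (ih i k) (h0 k j)

lemma pow_mulVec_of_fixed {v : Fin m → ℝ} (hv : P *ᵥ v = v) (t : ℕ) : (P ^ t) *ᵥ v = v := by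
  induction t with
  | zero => simp
  | succ t ih => rw [pow_succ, ← Matrix.mulVec_mulVec, hv, ih]

/-- A power of a primitive column-stochastic matrix contracts the `ℓ¹` norm of the vectors of
total mass zero. -/
lemma exists_pow_contraction (hm : 0 < m) (hP : P.IsPrimitive) (hs : ∀ j, ∑ i, P i j = 1) :
    ∃ k : ℕ, 0 < k ∧ ∃ q : ℝ, 0 ≤ q ∧ q < 1 ∧ ∀ v : Fin m → ℂ, ∑ j, v j = 0 →
      ∑ i, ‖∑ j, ((P ^ k) i j : ℂ) * v j‖ ≤ q * ∑ j, ‖v j‖ := by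
  obtain ⟨k, hk, hpos⟩ := hP.exists_pos_pow
  have : Nonempty (Fin m) := ⟨⟨0, hm⟩⟩
  obtain ⟨p, -, hp⟩ := Finset.exists_min_image (Finset.univ : Finset (Fin m × Fin m))
    (fun p => (P ^ k) p.1 p.2) Finset.univ_nonempty
  set ε := (P ^ k) p.1 p.2 with hε
  have hεpos : 0 < ε := hpos _ _
  have hle : ∀ i j, ε ≤ (P ^ k) i j := fun i j => hp (i, j) (Finset.mem_univ _)
  have hmε : (m : ℝ) * ε ≤ 1 := by
    rw [← colStochastic_pow hs k ⟨0, hm⟩]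
    calc (m : ℝ) * ε = ∑ _i : Fin m, ε := by simp
      _ ≤ _ := Finset.sum_le_sum fun i _ => hle i _
  -- `P ^ k - ε` is entrywise nonnegative and each of its columns sums to `1 - m ε`, which is
  -- therefore its `ℓ¹` contraction factor.
  refine ⟨k, hk, 1 - m * ε, by linarith, ?_, fun v hv => ?_⟩
  · have : (0 : ℝ) < m := by exact_mod_cast hm
    nlinarith [mul_pos this hεpos]
  have key : ∀ i, ‖∑ j, ((P ^ k) i j : ℂ) * v j‖ ≤ ∑ j, ((P ^ k) i j - ε) * ‖v j‖ := by
    intro i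
    have : ∑ j, ((P ^ k) i j : ℂ) * v j = ∑ j, (((P ^ k) i j - ε : ℝ) : ℂ) * v j := by
      have h0 : ∑ j, (ε : ℂ) * v j = 0 := by rw [← Finset.mul_sum, hv, mul_zero]
      simp only [Complex.ofReal_sub, sub_mul, Finset.sum_sub_distrib, h0, sub_zero]
    rw [this]
    refine (norm_sum_le _ _).trans (Finset.sum_le_sum fun j _ => ?_)
    rw [norm_mul, Complex.norm_real, Real.norm_of_nonneg (by linarith [hle i j])]
  refine (Finset.sum_le_sum fun i _ => key i).trans ?_
  rw [Finset.sum_comm]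
  simp only [← Finset.sum_mul, Finset.sum_sub_distrib, colStochastic_pow hs]
  simp [Finset.mul_sum]

/-- Powers of the complexification act on an eigenvector by powers of the eigenvalue. -/
lemma pow_mulVec_eigen {A : Matrix (Fin m) (Fin m) ℂ} {v : Fin m → ℂ} {μ : ℂ}
    (hv : A *ᵥ v = μ • v) (t : ℕ) : (A ^ t) *ᵥ v = μ ^ t • v := by
  induction t with
  | zero => simp
  | succ t ih => rw [pow_succ, ← Matrix.mulVec_mulVec, hv, Matrix.mulVec_smul, ih, smul_smul,
      pow_succ, mul_comm]

lemma map_ofReal_pow (P : Matrix (Fin m) (Fin m) ℝ) (t : ℕ) :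
    (P.map Complex.ofReal) ^ t = (P ^ t).map Complex.ofReal :=
  (map_pow (Complex.ofRealHom.mapMatrix (m := Fin m)) P t).symm

/-- Contraction applied to the eigenvector itself gives `‖μ‖ ^ k ≤ q < 1`. -/
lemma norm_eigenvalue_lt_one (hm : 0 < m) (hP : P.IsPrimitive)
    (hs : ∀ j, ∑ i, P i j = 1) {v : Fin m → ℂ} {μ : ℂ}
    (hv : (P.map Complex.ofReal) *ᵥ v = μ • v) (h0 : ∑ j, v j = 0) (hne : v ≠ 0) : ‖μ‖ < 1 := by
  obtain ⟨k, hk, q, hq0, hq1, hc⟩ := exists_pow_contraction hm hP hs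
  have h1 := hc v h0
  have h2 : ∀ i, ∑ j, ((P ^ k) i j : ℂ) * v j = μ ^ k * v i := fun i => by
    have := congrFun (pow_mulVec_eigen hv k) i
    rw [map_ofReal_pow] at this
    simpa [Matrix.mulVec, dotProduct] using this
  simp only [h2, norm_mul, norm_pow, ← Finset.mul_sum] at h1
  have hpos : 0 < ∑ j, ‖v j‖ := by
    obtain ⟨i, hi⟩ := Function.ne_iff.mp hne
    exact Finset.sum_pos' (fun _ _ => norm_nonneg _) ⟨i, Finset.mem_univ _, norm_pos_iff.mpr hi⟩
  have h3 : ‖μ‖ ^ k < 1 := lt_of_le_of_lt (le_of_mul_le_mul_right h1 hpos) hq1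
  by_contra hcon
  exact absurd (one_le_pow₀ (not_lt.mp hcon)) (not_le.mpr h3)

/-- The row of ones is a left eigenvector, so `P - 1` is singular and has a real kernel vector `v`.
Entrywise `|v| ≤ P |v|`, and both sides have the same total mass, so equality holds; a positive
power then makes `|v|` strictly positive. -/
lemma exists_isPerronVector (hm : 0 < m) (hP : P.IsPrimitive) (hs : ∀ j, ∑ i, P i j = 1) :
    ∃ π, IsPerronVector P π := by
  have hdet : (P - 1).det = 0 := by
    rw [← Matrix.exists_vecMul_eq_zero_iff]
    refine ⟨fun _ => 1, ?_, ?_⟩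
    · intro h
      simpa using congrFun h ⟨0, hm⟩
    · ext j
      simp [Matrix.vecMul, dotProduct, hs, Matrix.one_apply]
  obtain ⟨v, hv0, hv⟩ := Matrix.exists_mulVec_eq_zero_iff.mpr hdet
  rw [Matrix.sub_mulVec, Matrix.one_mulVec, sub_eq_zero] at hv
  set y : Fin m → ℝ := fun i => |v i| with hy
  have hle : ∀ i ∈ Finset.univ, y i ≤ (P *ᵥ y) i := by
    intro i _
    have : v i = ∑ j, P i j * v j := (congrFun hv i).symm
    simp only [hy, Matrix.mulVec, dotProduct]
    rw [this]
    refine (Finset.abs_sum_le_sum_abs _ _).trans (le_of_eq ?_)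
    simp [abs_mul, abs_of_nonneg (hP.nonneg _ _)]
  have hfix : P *ᵥ y = y := by
    have := (Finset.sum_eq_sum_iff_of_le hle).mp (sum_mulVec_of_colStochastic hs y).symm
    ext i; exact (this i (Finset.mem_univ _)).symm
  obtain ⟨k, hk, hpos⟩ := hP.exists_pos_pow
  obtain ⟨i0, hi0⟩ := Function.ne_iff.mp hv0
  have hypos : ∀ i, 0 < y i := by
    intro i
    rw [← congrFun (pow_mulVec_of_fixed hfix k) i]
    exact Finset.sum_pos' (fun j _ => mul_nonneg (hpos i j).le (abs_nonneg _))
      ⟨i0, Finset.mem_univ _, mul_pos (hpos i i0) (abs_pos.mpr hi0)⟩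
  have hsum : 0 < ∑ i, y i := Finset.sum_pos (fun i _ => hypos i) ⟨⟨0, hm⟩, Finset.mem_univ _⟩
  refine ⟨(∑ i, y i)⁻¹ • y, fun i => mul_pos (inv_pos.mpr hsum) (hypos i), ?_, ?_⟩
  · simp only [Pi.smul_apply, smul_eq_mul, ← Finset.mul_sum]
    exact inv_mul_cancel₀ hsum.ne'
  · rw [Matrix.mulVec_smul, hfix]

/-- A nonzero difference would be an eigenvector of mass zero for the eigenvalue `1`, against the
contraction. -/
lemma IsPerronVector.unique (hm : 0 < m) (hP : P.IsPrimitive) (hs : ∀ j, ∑ i, P i j = 1)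
    {π ρ : Fin m → ℝ} (hπ : IsPerronVector P π) (hρ : IsPerronVector P ρ) : π = ρ := by
  by_contra hne
  have hne' : (fun i => ((π i - ρ i : ℝ) : ℂ)) ≠ 0 := by
    intro h
    refine hne (funext fun i => ?_)
    have := congrFun h i
    simp only [Pi.zero_apply, Complex.ofReal_eq_zero] at this
    linarith
  refine absurd (norm_eigenvalue_lt_one hm hP hs (μ := 1) ?_ ?_ hne') (by simp)
  · ext i
    have h1 := congrFun hπ.fixed i
    have h2 := congrFun hρ.fixed i
    simp only [Matrix.mulVec, dotProduct] at h1 h2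
    simp only [Matrix.mulVec, dotProduct, Matrix.map_apply, one_smul]
    rw [← h1, ← h2, ← Finset.sum_sub_distrib]
    push_cast
    exact Finset.sum_congr rfl fun j _ => by ring
  · rw [← Complex.ofReal_sum, Finset.sum_sub_distrib, hπ.sum_eq_one, hρ.sum_eq_one]
    simp

lemma exists_eigenvector {A : Matrix (Fin m) (Fin m) ℂ} {μ : ℂ} (hμ : μ ∈ spectrum ℂ A) :
    ∃ v, v ≠ 0 ∧ A *ᵥ v = μ • v := by
  rw [← Matrix.spectrum_toLin', ← Module.End.hasEigenvalue_iff_mem_spectrum] at hμ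
  obtain ⟨v, hv⟩ := hμ.exists_hasEigenvector
  exact ⟨v, hv.2, by simpa using hv.apply_eq_smul⟩

lemma mem_spectrum_of_eigenvector {A : Matrix (Fin m) (Fin m) ℂ} {μ : ℂ} {v : Fin m → ℂ}
    (hv0 : v ≠ 0) (hv : A *ᵥ v = μ • v) : μ ∈ spectrum ℂ A := by
  rw [← Matrix.spectrum_toLin', ← Module.End.hasEigenvalue_iff_mem_spectrum]
  exact Module.End.hasEigenvalue_of_hasEigenvector (x := v)
    (Module.End.hasEigenvector_iff.mpr ⟨by simpa [Module.End.mem_eigenspace_iff] using hv, hv0⟩)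

/-- An eigenvector for an eigenvalue other than `1` has total mass zero. -/
lemma sum_eigenvector_eq_zero (hs : ∀ j, ∑ i, P i j = 1) {v : Fin m → ℂ} {μ : ℂ}
    (hv : (P.map Complex.ofReal) *ᵥ v = μ • v) (hμ : μ ≠ 1) : ∑ j, v j = 0 := by
  have h1 : ∑ i, ((P.map Complex.ofReal) *ᵥ v) i = ∑ j, v j := by
    simp only [Matrix.mulVec, dotProduct, Matrix.map_apply]
    rw [Finset.sum_comm]
    simp [← Finset.sum_mul, ← Complex.ofReal_sum, hs]
  rw [hv] at h1
  simp only [Pi.smul_apply, smul_eq_mul, ← Finset.mul_sum] at h1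
  have : (μ - 1) * ∑ j, v j = 0 := by rw [sub_mul, h1, one_mul, sub_self]
  exact (mul_eq_zero.mp this).resolve_left (sub_ne_zero.mpr hμ)

lemma norm_lt_one_of_mem_spectrum (hm : 0 < m) (hP : P.IsPrimitive) (hs : ∀ j, ∑ i, P i j = 1)
    {μ : ℂ} (h : μ ∈ spectrum ℂ (P.map Complex.ofReal)) (hμ : μ ≠ 1) : ‖μ‖ < 1 := by
  obtain ⟨v, hv0, hv⟩ := exists_eigenvector h
  exact norm_eigenvalue_lt_one hm hP hs hv (sum_eigenvector_eq_zero hs hv hμ) hv0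

lemma finite_slem_set (P : Matrix (Fin m) (Fin m) ℝ) :
    {x : ℝ | ∃ μ ∈ spectrum ℂ (P.map Complex.ofReal), μ ≠ 1 ∧ x = ‖μ‖}.Finite := by
  refine ((Matrix.finite_spectrum (P.map Complex.ofReal)).image norm).subset ?_
  rintro x ⟨μ, h, -, rfl⟩
  exact ⟨μ, h, rfl⟩

lemma norm_le_slem {μ : ℂ} (h : μ ∈ spectrum ℂ (P.map Complex.ofReal)) (hμ : μ ≠ 1) :
    ‖μ‖ ≤ slem P :=
  le_csSup (finite_slem_set P).bddAbove ⟨μ, h, hμ, rfl⟩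

lemma slem_nonneg (P : Matrix (Fin m) (Fin m) ℝ) : 0 ≤ slem P :=
  Real.sSup_nonneg (by rintro x ⟨μ, -, -, rfl⟩; exact norm_nonneg _)

/-- The spectrum is finite, so the supremum is attained and the strict bound on each eigenvalue
survives; with no eigenvalue other than `1`, the supremum of the empty set is `0`. -/
lemma slem_lt_one (hm : 0 < m) (hP : P.IsPrimitive) (hs : ∀ j, ∑ i, P i j = 1) :
    slem P < 1 := by
  rcases Set.eq_empty_or_nonempty
    {x : ℝ | ∃ μ ∈ spectrum ℂ (P.map Complex.ofReal), μ ≠ 1 ∧ x = ‖μ‖} with h | h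
  · rw [slem, h, Real.sSup_empty]; exact one_pos
  · obtain ⟨μ, h1, h2, h3⟩ := h.csSup_mem (finite_slem_set P)
    rw [slem, h3]
    exact norm_lt_one_of_mem_spectrum hm hP hs h1 h2

end Perron
-- Geometric mixing from the spectral gap.
section Mixing

attribute [local instance] Matrix.linftyOpNormedRing Matrix.linftyOpNormedAlgebra

variable {m : ℕ} {P : Matrix (Fin m) (Fin m) ℝ} {π : Fin m → ℝ}

/-- The complex matrix `P - π 1ᵀ`. -/
def deflated (P : Matrix (Fin m) (Fin m) ℝ) (π : Fin m → ℝ) : Matrix (Fin m) (Fin m) ℂ :=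
  P.map Complex.ofReal - Matrix.of fun i _ => (π i : ℂ)

/-- For `Q = π 1ᵀ` one has `P Q = Q P = Q Q = Q`, so all cross terms collapse. Exponents start at
one: the zeroth power is the identity, not `1 - Q`. -/
lemma deflated_pow_succ (hs : ∀ j, ∑ i, P i j = 1) (hπ : IsPerronVector P π) (t : ℕ) :
    deflated P π ^ (t + 1) = (P ^ (t + 1)).map Complex.ofReal - Matrix.of fun i _ => (π i : ℂ) := by
  set Q : Matrix (Fin m) (Fin m) ℂ := Matrix.of fun i _ => (π i : ℂ) with hQ
  have hPQ : ∀ t, ((P ^ t).map Complex.ofReal) * Q = Q := by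
    intro t
    ext i j
    have h1 := congrFun (pow_mulVec_of_fixed hπ.fixed t) i
    simp only [Matrix.mulVec, dotProduct] at h1
    simp only [Matrix.mul_apply, hQ, Matrix.of_apply, Matrix.map_apply]
    rw [← h1]
    push_cast
    rfl
  have hQP : Q * (P.map Complex.ofReal) = Q := by
    ext i j
    simp [Matrix.mul_apply, hQ, ← Finset.mul_sum, ← Complex.ofReal_sum, hs]
  have hQQ : Q * Q = Q := by
    ext i j
    simp [Matrix.mul_apply, hQ, ← Finset.mul_sum, ← Complex.ofReal_sum, hπ.sum_eq_one]
  induction t with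
  | zero => simp [deflated, hQ]
  | succ t ih =>
    rw [pow_succ, ih, deflated, ← hQ, sub_mul, mul_sub, mul_sub, hPQ, hQP, hQQ,
      ← map_ofReal_pow, ← map_ofReal_pow, pow_succ (P.map Complex.ofReal) (t + 1)]
    abel

/-- The columns of `P - π 1ᵀ` sum to zero, so an eigenvector for `μ ≠ 0` has mass zero. On it `π 1ᵀ`
vanishes, hence `μ` is an eigenvalue of `P`, and `μ ≠ 1` by the contraction. -/
lemma norm_le_slem_of_mem_spectrum_deflated (hm : 0 < m) (hP : P.IsPrimitive)
    (hs : ∀ j, ∑ i, P i j = 1) (hπ : IsPerronVector P π) {μ : ℂ}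
    (h : μ ∈ spectrum ℂ (deflated P π)) : ‖μ‖ ≤ slem P := by
  rcases eq_or_ne μ 0 with rfl | hμ
  · simpa using slem_nonneg P
  obtain ⟨v, hv0, hv⟩ := exists_eigenvector h
  have h0 : ∑ j, v j = 0 := by
    have h1 : ∑ i, (deflated P π *ᵥ v) i = 0 := by
      simp only [Matrix.mulVec, dotProduct, deflated, Matrix.sub_apply, Matrix.map_apply,
        Matrix.of_apply]
      rw [Finset.sum_comm]
      simp [← Finset.sum_mul, ← Complex.ofReal_sum, hs, hπ.sum_eq_one]
    rw [hv] at h1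
    simp only [Pi.smul_apply, smul_eq_mul, ← Finset.mul_sum] at h1
    exact (mul_eq_zero.mp h1).resolve_left hμ
  have hv' : (P.map Complex.ofReal) *ᵥ v = μ • v := by
    rw [← hv, deflated, Matrix.sub_mulVec]
    have : (Matrix.of fun i (_ : Fin m) => (π i : ℂ)) *ᵥ v = 0 := by
      ext i
      simp [Matrix.mulVec, dotProduct, ← Finset.mul_sum, h0]
    rw [this, sub_zero]
  refine norm_le_slem (mem_spectrum_of_eigenvector hv0 hv') ?_
  rintro rfl
  simpa using norm_eigenvalue_lt_one hm hP hs hv' h0 hv0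

/-- By Gelfand's formula the powers of the deflated matrix are eventually below `lam ^ t` in norm;
the finitely many earlier times are absorbed in the constant. -/
lemma exists_isMixingConstant (hm : 0 < m) (hP : P.IsPrimitive) (hs : ∀ j, ∑ i, P i j = 1)
    (hπ : IsPerronVector P π) {lam : ℝ} (h : slem P < lam) : ∃ C, IsMixingConstant P π lam C := by
  have : Nonempty (Fin m) := ⟨⟨0, hm⟩⟩
  have hlam : 0 < lam := (slem_nonneg P).trans_lt h
  have hρ : spectralRadius ℂ (deflated P π) < ENNReal.ofReal lam := by
    refine lt_of_le_of_lt ?_ ((ENNReal.ofReal_lt_ofReal_iff hlam).mpr h)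
    refine iSup₂_le fun μ hμ => ?_
    rw [← enorm_eq_nnnorm, ← ofReal_norm]
    exact ENNReal.ofReal_le_ofReal (norm_le_slem_of_mem_spectrum_deflated hm hP hs hπ hμ)
  have hev := (spectrum.pow_norm_pow_one_div_tendsto_nhds_spectralRadius
    (deflated P π)).eventually_lt_const hρ
  obtain ⟨N, hN⟩ := Filter.eventually_atTop.mp hev
  set b : ℕ → ℝ := fun t => ∑ i, ∑ j, |(P ^ t) i j - π i| with hb
  have hbnn : ∀ t, 0 ≤ b t := fun t =>
    Finset.sum_nonneg fun _ _ => Finset.sum_nonneg fun _ _ => abs_nonneg _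
  refine ⟨1 + ∑ t ∈ Finset.range (N + 1), b t / lam ^ t, fun t i => ?_⟩
  have hnn : 0 ≤ ∑ t ∈ Finset.range (N + 1), b t / lam ^ t :=
    Finset.sum_nonneg fun t _ => div_nonneg (hbnn t) (pow_pos hlam t).le
  rcases lt_or_ge t (N + 1) with ht | ht
  · have h1 : ∑ j, |(P ^ t) i j - π i| ≤ b t :=
      Finset.single_le_sum (f := fun i => ∑ j, |(P ^ t) i j - π i|)
        (fun _ _ => Finset.sum_nonneg fun _ _ => abs_nonneg _) (Finset.mem_univ i)
    have h2 : b t / lam ^ t ≤ ∑ t ∈ Finset.range (N + 1), b t / lam ^ t :=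
      Finset.single_le_sum (f := fun t => b t / lam ^ t)
        (fun t _ => div_nonneg (hbnn t) (pow_pos hlam t).le) (Finset.mem_range.mpr ht)
    rw [div_le_iff₀ (pow_pos hlam t)] at h2
    nlinarith [pow_pos hlam t]
  · obtain ⟨s, rfl⟩ : ∃ s, t = s + 1 := ⟨t - 1, by omega⟩
    have h1 := hN (s + 1) (by omega)
    rw [ENNReal.ofReal_lt_ofReal_iff hlam] at h1
    have h2 : ‖deflated P π ^ (s + 1)‖ ≤ lam ^ (s + 1) := by
      have h3 := pow_le_pow_left₀ (by positivity) h1.le (s + 1)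
      rwa [← Real.rpow_natCast, ← Real.rpow_mul (norm_nonneg _), one_div,
        inv_mul_cancel₀ (by positivity), Real.rpow_one] at h3
    -- The local norm is the operator norm induced by the sup norm, the maximal absolute row sum, so
    -- it dominates each row sum.
    have h3 : ∑ j, |(P ^ (s + 1)) i j - π i| ≤ ‖deflated P π ^ (s + 1)‖ := by
      rw [Matrix.linfty_opNorm_def]
      have h4 : (∑ j, ‖(deflated P π ^ (s + 1)) i j‖₊) ≤
          Finset.univ.sup fun i => ∑ j, ‖(deflated P π ^ (s + 1)) i j‖₊ :=
        Finset.le_sup (f := fun i => ∑ j, ‖(deflated P π ^ (s + 1)) i j‖₊) (Finset.mem_univ i)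
      refine le_trans (le_of_eq ?_) (NNReal.coe_le_coe.mpr h4)
      push_cast
      refine Finset.sum_congr rfl fun j _ => ?_
      rw [deflated_pow_succ hs hπ, Matrix.sub_apply, Matrix.map_apply, Matrix.of_apply,
        ← Complex.ofReal_sub, Complex.norm_real, Real.norm_eq_abs]
    nlinarith [pow_pos hlam (s + 1)]

lemma tendsto_pow_entry (hm : 0 < m) (hP : P.IsPrimitive) (hs : ∀ j, ∑ i, P i j = 1)
    (hπ : IsPerronVector P π) (i j : Fin m) :
    Filter.Tendsto (fun t => (P ^ t) i j) Filter.atTop (nhds (π i)) := by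
  obtain ⟨lam, h1, h2⟩ := exists_between (slem_lt_one hm hP hs)
  obtain ⟨C, hC⟩ := exists_isMixingConstant hm hP hs hπ h1
  rw [tendsto_iff_norm_sub_tendsto_zero]
  refine squeeze_zero (fun _ => norm_nonneg _) (g := fun t => C * lam ^ t) (fun t => ?_) ?_
  · exact (Finset.single_le_sum (f := fun j => |(P ^ t) i j - π i|) (fun _ _ => abs_nonneg _)
      (Finset.mem_univ j)).trans (hC t i)
  · simpa using (tendsto_pow_atTop_nhds_zero_of_lt_one
      ((slem_nonneg P).trans h1.le) h2).const_mul C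

/-- In the expansion of `P ^ t` along the eigenvalues, the terms with eigenvalue `1` add up to `π`
and all others are at most a constant times `slem P ^ t`. -/
lemma exists_isMixingConstant_slem (hm : 0 < m) (hP : P.IsPrimitive) (hs : ∀ j, ∑ i, P i j = 1)
    (hπ : IsPerronVector P π) (hd : IsDiagonalizable P) :
    ∃ C, IsMixingConstant P π (slem P) C := by
  obtain ⟨V, e, hV, hPV⟩ := hd
  have hVl : V⁻¹ * V = 1 := Matrix.nonsing_inv_mul V hV
  have hVr : V * V⁻¹ = 1 := Matrix.mul_nonsing_inv V hV
  have hpow : ∀ t, (P.map Complex.ofReal) ^ t = V * Matrix.diagonal (fun k => e k ^ t) * V⁻¹ := by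
    intro t
    induction t with
    | zero => simp [hVr]
    | succ t ih =>
      rw [pow_succ, ih, hPV, ← mul_assoc, ← mul_assoc, mul_assoc (V * _) V⁻¹ V, hVl, mul_one,
        mul_assoc V, Matrix.diagonal_mul_diagonal]
      simp only [pow_succ]
  have hent : ∀ t i j, (((P ^ t) i j : ℝ) : ℂ) = ∑ k, V i k * e k ^ t * V⁻¹ k j := by
    intro t i j
    have := congrFun (congrFun (hpow t) i) j
    rw [map_ofReal_pow, Matrix.map_apply] at this
    rw [this, Matrix.mul_apply]
    simp [Matrix.mul_diagonal]
  have hspec : ∀ k, e k ∈ spectrum ℂ (P.map Complex.ofReal) := by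
    intro k
    refine mem_spectrum_of_eigenvector (v := fun i => V i k) ?_ ?_
    · intro h0
      have h1 := congrFun (congrFun hVl k) k
      rw [Matrix.mul_apply] at h1
      simp [fun i => congrFun h0 i] at h1
    · have h1 : P.map Complex.ofReal * V = V * Matrix.diagonal e := by
        rw [hPV, mul_assoc, hVl, mul_one]
      ext i
      have h2 := congrFun (congrFun h1 i) k
      rw [Matrix.mul_diagonal, Matrix.mul_apply] at h2
      simpa [Matrix.mulVec, dotProduct, mul_comm] using h2
  -- The part belonging to the eigenvalue `1` is identified as the limit of `P ^ t`, so no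
  -- simplicity of that eigenvalue is needed.
  have hlim : ∀ i j, (π i : ℂ) = ∑ k, V i k * (if e k = 1 then 1 else 0) * V⁻¹ k j := by
    intro i j
    have h1 : Filter.Tendsto (fun t => (((P ^ t) i j : ℝ) : ℂ)) Filter.atTop (nhds (π i : ℂ)) :=
      (Complex.continuous_ofReal.tendsto _).comp (tendsto_pow_entry hm hP hs hπ i j)
    refine tendsto_nhds_unique h1 ?_
    simp only [hent]
    refine tendsto_finsetSum _ fun k _ => (Filter.Tendsto.const_mul _ ?_).mul_const _
    split_ifs with hk
    · exact tendsto_const_nhds.congr fun t => by simp [hk]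
    · exact tendsto_pow_atTop_nhds_zero_of_norm_lt_one
        (norm_lt_one_of_mem_spectrum hm hP hs (hspec k) hk)
  refine ⟨∑ i, ∑ j, ∑ k, ‖V i k‖ * ‖V⁻¹ k j‖, fun t i => ?_⟩
  have h1 : ∑ j, |(P ^ t) i j - π i| ≤ (∑ j, ∑ k, ‖V i k‖ * ‖V⁻¹ k j‖) * slem P ^ t := by
    rw [Finset.sum_mul]
    refine Finset.sum_le_sum fun j _ => ?_
    rw [← Real.norm_eq_abs, ← Complex.norm_real, Complex.ofReal_sub, hent, hlim i j,
      ← Finset.sum_sub_distrib, Finset.sum_mul]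
    refine (norm_sum_le _ _).trans (Finset.sum_le_sum fun k _ => ?_)
    rw [← sub_mul, ← mul_sub, norm_mul, norm_mul, mul_right_comm]
    refine mul_le_mul_of_nonneg_left ?_ (by positivity)
    split_ifs with hk
    · simpa [hk] using pow_nonneg (slem_nonneg P) t
    · rw [sub_zero, norm_pow]
      exact pow_le_pow_left₀ (norm_nonneg _) (norm_le_slem (hspec k) hk) t
  refine h1.trans (mul_le_mul_of_nonneg_right ?_ (pow_nonneg (slem_nonneg P) t))
  exact Finset.single_le_sum (f := fun i => ∑ j, ∑ k, ‖V i k‖ * ‖V⁻¹ k j‖)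
    (fun _ _ => Finset.sum_nonneg fun _ _ => Finset.sum_nonneg fun _ _ => by positivity)
    (Finset.mem_univ i)

end Mixing

/-! ### Convex smooth functions -/

section ConvexSmooth

variable {E : Type*} [NormedAddCommGroup E] [InnerProductSpace ℝ E] [CompleteSpace E] {g : E → ℝ}

lemma norm_gradient_le_of_lipschitz {G : ℝ} (hG : 0 ≤ G)
    (h : ∀ x y, |g y - g x| ≤ G * ‖y - x‖) (x : E) : ‖gradient g x‖ ≤ G := by
  have hl : LipschitzWith ⟨G, hG⟩ g := LipschitzWith.of_dist_le_mul fun x y => by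
    rw [Real.dist_eq, dist_eq_norm]; exact h y x
  have := norm_fderiv_le_of_lipschitz ℝ hl (x₀ := x)
  rw [gradient, LinearIsometryEquiv.norm_map]
  exact this

lemma hasDerivAt_comp_line (hd : Differentiable ℝ g) (x h : E) (t : ℝ) :
    HasDerivAt (fun t : ℝ => g (x + t • h)) (inner ℝ (gradient g (x + t • h)) h) t := by
  have h1 : HasDerivAt (fun t : ℝ => x + t • h) h t := by
    simpa using ((hasDerivAt_id t).smul_const h).const_add x
  exact ((hd (x + t • h)).hasGradientAt.hasFDerivAt.comp_hasDerivAt t h1).congr_deriv (by simp)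

/-- On the line from `x` to `y`, the derivative at `0` of a convex function is at most its slope
over `[0, 1]`. -/
lemma ConvexOn.add_inner_gradient_le (hc : ConvexOn ℝ Set.univ g) (hd : Differentiable ℝ g)
    (x y : E) : g x + inner ℝ (gradient g x) (y - x) ≤ g y := by
  have h1 : ConvexOn ℝ Set.univ (fun t : ℝ => g (x + t • (y - x))) := by
    have h := hc.comp_affineMap (AffineMap.lineMap x y : ℝ →ᵃ[ℝ] E)
    have e : (fun t : ℝ => g (x + t • (y - x))) = g ∘ (AffineMap.lineMap x y : ℝ →ᵃ[ℝ] E) := by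
      ext t
      simp [AffineMap.lineMap_apply, add_comm]
    rw [e]
    exact h
  have h2 := h1.le_slope_of_hasDerivAt (Set.mem_univ 0) (Set.mem_univ 1) one_pos
    (hasDerivAt_comp_line hd x (y - x) 0)
  simp [slope_def_field, -inner_gradient_left] at h2
  linarith

/-- Along the segment, `g` minus the quadratic model has nonpositive derivative, because the
gradient at parameter `t` has changed by at most `L t ‖h‖`. -/
lemma le_add_inner_gradient_add_sq (hd : Differentiable ℝ g) {L : ℝ}
    (hs : ∀ x y, ‖gradient g y - gradient g x‖ ≤ L * ‖y - x‖) (x y : E) :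
    g y ≤ g x + inner ℝ (gradient g x) (y - x) + L / 2 * ‖y - x‖ ^ 2 := by
  set h := y - x with hh
  have hderiv : ∀ t : ℝ, HasDerivAt
      (fun t : ℝ => g (x + t • h) - (t * inner ℝ (gradient g x) h + L / 2 * t ^ 2 * ‖h‖ ^ 2))
      (inner ℝ (gradient g (x + t • h)) h - (inner ℝ (gradient g x) h + L * t * ‖h‖ ^ 2)) t := by
    intro t
    refine (hasDerivAt_comp_line hd x h t).sub (HasDerivAt.add ?_ ?_)
    · simpa using (hasDerivAt_id t).mul_const (inner ℝ (gradient g x) h)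
    · have := ((((hasDerivAt_id t).pow 2).const_mul (L / 2)).mul_const (‖h‖ ^ 2))
      refine (this.congr_deriv ?_).congr_of_eventuallyEq ?_
      · simp only [id_eq]; push_cast; ring
      · exact Filter.Eventually.of_forall fun _ => rfl
  have hanti := antitoneOn_of_deriv_nonpos (convex_Icc (0 : ℝ) 1)
    (fun t _ => (hderiv t).continuousAt.continuousWithinAt)
    (fun t _ => (hderiv t).differentiableAt.differentiableWithinAt) (fun t ht => by
      rw [(hderiv t).deriv]
      rw [interior_Icc] at ht
      have h1 : inner ℝ (gradient g (x + t • h) - gradient g x) h ≤ L * t * ‖h‖ ^ 2 := by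
        refine (real_inner_le_norm _ _).trans ?_
        have h2 := hs x (x + t • h)
        rw [add_sub_cancel_left, norm_smul, Real.norm_of_nonneg ht.1.le] at h2
        calc _ ≤ (L * (t * ‖h‖)) * ‖h‖ := mul_le_mul_of_nonneg_right h2 (norm_nonneg _)
          _ = _ := by ring
      rw [inner_sub_left] at h1
      linarith)
  have := hanti (Set.left_mem_Icc.mpr zero_le_one) (Set.right_mem_Icc.mpr zero_le_one) zero_le_one
  simp [hh, -inner_gradient_left] at this
  simp only [hh]
  linarith

/-- Co-coercivity of the gradient of a convex smooth function. -/
lemma sq_norm_gradient_sub_le (hc : ConvexOn ℝ Set.univ g) (hd : Differentiable ℝ g) {L : ℝ}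
    (hL : 0 < L) (hs : ∀ x y, ‖gradient g y - gradient g x‖ ≤ L * ‖y - x‖) (x y : E) :
    ‖gradient g y - gradient g x‖ ^ 2 ≤ L * inner ℝ (gradient g y - gradient g x) (y - x) := by
  -- The test point `y - L⁻¹ D` minimizes the quadratic upper model at `y` after subtraction of the
  -- tangent plane at `x`; comparing that tangent plane with the model there gives the gain `‖D‖² /
  -- (2 L)`. The claim is the sum of this inequality and its mirror image.
  have half : ∀ x y, g x + inner ℝ (gradient g x) (y - x)
      + 1 / (2 * L) * ‖gradient g y - gradient g x‖ ^ 2 ≤ g y := by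
    intro x y
    set D := gradient g y - gradient g x with hD
    have h1 := hc.add_inner_gradient_le hd x (y - L⁻¹ • D)
    have h2 := le_add_inner_gradient_add_sq hd hs y (y - L⁻¹ • D)
    have e1 : y - L⁻¹ • D - x = (y - x) - L⁻¹ • D := by abel
    have e2 : y - L⁻¹ • D - y = -(L⁻¹ • D) := by abel
    rw [e1, inner_sub_right, real_inner_smul_right] at h1
    rw [e2, inner_neg_right, real_inner_smul_right, norm_neg, norm_smul,
      Real.norm_of_nonneg (inv_nonneg.mpr hL.le)] at h2
    have e3 : inner ℝ (gradient g y) D - inner ℝ (gradient g x) D = ‖D‖ ^ 2 := by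
      rw [← inner_sub_left, ← hD, real_inner_self_eq_norm_sq]
    have e4 : L / 2 * (L⁻¹ * ‖D‖) ^ 2 = 1 / (2 * L) * ‖D‖ ^ 2 := by field_simp
    have e5 : L⁻¹ * inner ℝ (gradient g y) D - L⁻¹ * inner ℝ (gradient g x) D
        = 2 * (1 / (2 * L) * ‖D‖ ^ 2) := by rw [← mul_sub, e3]; field_simp
    linarith
  have h1 := half x y
  have h2 := half y x
  rw [norm_sub_rev (gradient g x)] at h2
  have e : inner ℝ (gradient g y) (x - y) = - inner ℝ (gradient g y) (y - x) := by
    rw [← inner_neg_right, neg_sub]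
  rw [e] at h2
  rw [inner_sub_left]
  have e2 : L * (2 * (1 / (2 * L) * ‖gradient g y - gradient g x‖ ^ 2))
      = ‖gradient g y - gradient g x‖ ^ 2 := by field_simp
  rw [← e2]
  exact mul_le_mul_of_nonneg_left (by linarith) hL.le

/-- A gradient step with step size at most `2 / L` is nonexpansive. -/
lemma norm_gradient_step_sub_le (hc : ConvexOn ℝ Set.univ g) (hd : Differentiable ℝ g) {L γ : ℝ}
    (hL : 0 < L) (hs : ∀ x y, ‖gradient g y - gradient g x‖ ≤ L * ‖y - x‖) (hγ : 0 ≤ γ)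
    (hγL : γ ≤ 2 / L) (x y : E) :
    ‖(y - γ • gradient g y) - (x - γ • gradient g x)‖ ≤ ‖y - x‖ := by
  have h1 := sq_norm_gradient_sub_le hc hd hL hs x y
  set D := gradient g y - gradient g x with hD
  have e : (y - γ • gradient g y) - (x - γ • gradient g x) = (y - x) - γ • D := by
    rw [hD, smul_sub]; abel
  rw [e]
  refine le_of_sq_le_sq ?_ (norm_nonneg _)
  rw [norm_sub_sq_real, real_inner_smul_right, real_inner_comm, norm_smul, mul_pow,
    Real.norm_of_nonneg hγ]
  rw [le_div_iff₀ hL] at hγL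
  -- This is co-coercivity combined with `γ L ≤ 2`; multiplied by `γ` it says that the quadratic
  -- term of the expanded square is beaten by the cross term.
  have h2 : γ * ‖D‖ ^ 2 ≤ 2 * inner ℝ D (y - x) := by
    have h3 : 0 ≤ inner ℝ D (y - x) := by
      by_contra hcon
      nlinarith [sq_nonneg ‖D‖]
    have : L * (γ * ‖D‖ ^ 2) ≤ L * (2 * inner ℝ D (y - x)) := by
      calc L * (γ * ‖D‖ ^ 2) = (γ * L) * ‖D‖ ^ 2 := by ring
        _ ≤ 2 * ‖D‖ ^ 2 := mul_le_mul_of_nonneg_right hγL (sq_nonneg _)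
        _ ≤ _ := by linarith
    exact le_of_mul_le_mul_left this hL
  nlinarith

end ConvexSmooth

/-! ### Consensus of the push-sum iterates -/

section Consensus

variable {m : ℕ} {P : Matrix (Fin m) (Fin m) ℝ} {π : Fin m → ℝ}

lemma pushWeight_eq (P : Matrix (Fin m) (Fin m) ℝ) (t : ℕ) (i : Fin m) :
    pushWeight P t i = ∑ j, (P ^ t) i j := by
  have : pushWeight P t = (P ^ t) *ᵥ (fun _ => 1) := by
    induction t with
    | zero => simp [pushWeight]
    | succ t ih => rw [pushWeight, ih, Matrix.mulVec_mulVec, pow_succ']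
  rw [this]
  simp [Matrix.mulVec, dotProduct]

lemma IsMixingConstant.nonneg (hm : 0 < m) {lam C : ℝ} (hC : IsMixingConstant P π lam C) :
    0 ≤ C := by
  have h := hC 0 ⟨0, hm⟩
  rw [pow_zero, pow_zero, mul_one] at h
  exact (Finset.sum_nonneg fun _ _ => abs_nonneg _).trans h

/-- The mixing bound at time `0` compares row `i` of the identity, of sum `1`, with the constant row
`π i`. This is what keeps all later constants free of `m`. -/
lemma IsMixingConstant.card_mul_le {lam C : ℝ} (hC : IsMixingConstant P π lam C) (i : Fin m) :
    m * π i ≤ C + 1 := by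
  have h : ∑ j, (π i - (1 : Matrix (Fin m) (Fin m) ℝ) i j) ≤ C := by
    have := hC 0 i
    rw [pow_zero, pow_zero, mul_one] at this
    refine (Finset.sum_le_sum fun j _ => ?_).trans this
    rw [abs_sub_comm]
    exact le_abs_self _
  rw [Finset.sum_sub_distrib] at h
  simp [Matrix.one_apply] at h
  linarith

lemma IsPerronVector.iInf_pos (hm : 0 < m) (hπ : IsPerronVector P π) : 0 < ⨅ i, π i := by
  have : Nonempty (Fin m) := ⟨⟨0, hm⟩⟩
  obtain ⟨i, hi⟩ := exists_eq_ciInf_of_finite (f := π)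
  rw [← hi]
  exact hπ.pos i

/-- Since `π j ≤ (C + 1) / m`, the vector of ones dominates `m / (C + 1) • π` entrywise; `P ^ t`
preserves this order and fixes `π`. -/
lemma le_pushWeight (hm : 0 < m) (h0 : ∀ i j, 0 ≤ P i j) (hπ : IsPerronVector P π) {lam C : ℝ}
    (hC : IsMixingConstant P π lam C) (t : ℕ) (i : Fin m) :
    m * (⨅ i, π i) / (C + 1) ≤ pushWeight P t i := by
  have hC0 := hC.nonneg hm
  have h1 : π i * (m / (C + 1)) ≤ pushWeight P t i := by
    rw [pushWeight_eq, ← congrFun (pow_mulVec_of_fixed hπ.fixed t) i]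
    simp only [Matrix.mulVec, dotProduct]
    rw [Finset.sum_mul]
    refine Finset.sum_le_sum fun j _ => ?_
    have : π j * (m / (C + 1)) ≤ 1 := by
      rw [← mul_div_assoc, div_le_one (by linarith), mul_comm]
      exact hC.card_mul_le j
    calc (P ^ t) i j * π j * (m / (C + 1)) = (P ^ t) i j * (π j * (m / (C + 1))) := by ring
      _ ≤ (P ^ t) i j * 1 := mul_le_mul_of_nonneg_left this (pow_entry_nonneg h0 t i j)
      _ = _ := mul_one _
  refine le_trans ?_ h1
  have h2 : (⨅ i, π i) ≤ π i := ciInf_le (Set.finite_range π).bddBelow i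
  calc m * (⨅ i, π i) / (C + 1) = (⨅ i, π i) * (m / (C + 1)) := by ring
    _ ≤ _ := mul_le_mul_of_nonneg_right h2 (by positivity)

/-- Bound on the distance of a de-biased iterate of round `t` to the consensus model. -/
def consensusBound (π : Fin m → ℝ) (G W lam C : ℝ) (γ : ℕ → ℝ) (t : ℕ) : ℝ :=
  2 * C * (C + 1) / (⨅ i, π i) *
    (W * lam ^ t + G * ∑ s ∈ Finset.range t, γ s * lam ^ (t - s))

lemma consensusBound_nonneg (hm : 0 < m) (hπ : IsPerronVector P π) {lam C G W : ℝ}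
    (hC : IsMixingConstant P π lam C) (hl : 0 ≤ lam) (hG : 0 ≤ G) (hW : 0 ≤ W) {γ : ℕ → ℝ}
    (hγ : ∀ t, 0 ≤ γ t) (t : ℕ) : 0 ≤ consensusBound π G W lam C γ t := by
  have := hC.nonneg hm
  have := hπ.iInf_pos hm
  have : 0 ≤ ∑ s ∈ Finset.range t, γ s * lam ^ (t - s) :=
    Finset.sum_nonneg fun s _ => mul_nonneg (hγ s) (pow_nonneg hl _)
  unfold consensusBound
  positivity

variable {E : Type*} [NormedAddCommGroup E] [NormedSpace ℝ E] {γ : ℕ → ℝ} {w g : ℕ → Fin m → E}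

lemma sum_smul_sum_smul (A B : Matrix (Fin m) (Fin m) ℝ) (x : Fin m → E) (i : Fin m) :
    ∑ j, A i j • ∑ k, B j k • x k = ∑ k, (A * B) i k • x k := by
  simp only [Finset.smul_sum, smul_smul, Matrix.mul_apply, Finset.sum_smul]
  exact Finset.sum_comm

/-- Closed form of the push-sum recursion. -/
lemma pushSum_unroll (hw : ∀ t i, w (t + 1) i = ∑ j, P i j • (w t j - γ t • g t j)) (t : ℕ)
    (i : Fin m) :
    w t i = ∑ j, (P ^ t) i j • w 0 j -
      ∑ s ∈ Finset.range t, γ s • ∑ j, (P ^ (t - s)) i j • g s j := by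
  induction t generalizing i with
  | zero => simp [Matrix.one_apply, ite_smul]
  | succ t ih =>
    rw [hw]
    simp only [ih, smul_sub, Finset.sum_sub_distrib]
    rw [sum_smul_sum_smul, ← pow_succ', Finset.sum_range_succ, Nat.add_sub_cancel_left, pow_one,
      ← sub_sub]
    congr 1
    · congr 1
      simp only [Finset.smul_sum (r := P i _)]
      rw [Finset.sum_comm]
      refine Finset.sum_congr rfl fun s hs => ?_
      rw [Nat.succ_sub (Finset.mem_range.mp hs).le, pow_succ', ← sum_smul_sum_smul,
        Finset.smul_sum]
      exact Finset.sum_congr rfl fun j _ => smul_comm _ _ _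
    · rw [Finset.smul_sum]
      exact Finset.sum_congr rfl fun j _ => smul_comm _ _ _

/-- The average of the iterates performs an averaged gradient step. -/
lemma pushSum_mean_succ (hs : ∀ j, ∑ i, P i j = 1)
    (hw : ∀ t i, w (t + 1) i = ∑ j, P i j • (w t j - γ t • g t j)) (t : ℕ) :
    ∑ i, w (t + 1) i = ∑ j, (w t j - γ t • g t j) := by
  simp only [hw]
  rw [Finset.sum_comm]
  simp only [← Finset.sum_smul, hs, one_smul]

lemma pushSum_sum_eq (hs : ∀ j, ∑ i, P i j = 1)
    (hw : ∀ t i, w (t + 1) i = ∑ j, P i j • (w t j - γ t • g t j)) (t : ℕ) :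
    ∑ i, w t i = ∑ j, w 0 j - ∑ s ∈ Finset.range t, γ s • ∑ j, g s j := by
  induction t with
  | zero => simp
  | succ t ih =>
    rw [pushSum_mean_succ hs hw, Finset.sum_sub_distrib, ih, Finset.sum_range_succ,
      Finset.smul_sum (r := γ t)]
    abel

/-- The de-biased iterates of push-sum stay close to the average. -/
lemma norm_debiased_sub_mean_le (hm : 0 < m) (h0 : ∀ i j, 0 ≤ P i j)
    (hs : ∀ j, ∑ i, P i j = 1) (hπ : IsPerronVector P π) {lam C G W : ℝ} (hl : 0 ≤ lam)
    (hl1 : lam < 1) (hG : 0 ≤ G) (hC : IsMixingConstant P π lam C) (hγ : ∀ t, 0 ≤ γ t)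
    (hw : ∀ t i, w (t + 1) i = ∑ j, P i j • (w t j - γ t • g t j)) (hg : ∀ t j, ‖g t j‖ ≤ G)
    (hW : (m : ℝ)⁻¹ * ∑ i, ‖w 0 i‖ ≤ W) (t : ℕ) (i : Fin m) :
    ‖(pushWeight P t i)⁻¹ • w t i - (m : ℝ)⁻¹ • ∑ j, w t j‖ ≤
      consensusBound π G W lam C γ t := by
  have hC0 := hC.nonneg hm
  have hmR : (0 : ℝ) < m := by exact_mod_cast hm
  have hδ := hπ.iInf_pos hm
  set δ := ⨅ i, π i with hδdef
  set u := pushWeight P t i with hu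
  have hule : m * δ / (C + 1) ≤ u := le_pushWeight hm h0 hπ hC t i
  have hlow : 0 < m * δ / (C + 1) := by positivity
  have hupos : 0 < u := hlow.trans_le hule
  set a : ℕ → Fin m → ℝ := fun q j => (P ^ q) i j - u / m with ha
  -- Both `(P ^ q) i j` and `u / m` are compared with `π i`. The first costs `C lam ^ q` over the
  -- row, the second `C lam ^ t`, which is no larger as `q ≤ t`.
  have hrow : ∀ q ≤ t, ∑ j, |a q j| ≤ 2 * C * lam ^ q := by
    intro q hq
    have h1 : |u - m * π i| ≤ C * lam ^ t := by
      rw [hu, pushWeight_eq]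
      have : ∑ j, (P ^ t) i j - m * π i = ∑ j, ((P ^ t) i j - π i) := by
        simp [Finset.sum_sub_distrib]
      rw [this]
      exact (Finset.abs_sum_le_sum_abs _ _).trans (hC t i)
    have h2 : lam ^ t ≤ lam ^ q := pow_le_pow_of_le_one hl hl1.le hq
    calc ∑ j, |a q j| ≤ ∑ j, (|(P ^ q) i j - π i| + |u - m * π i| / m) := by
          refine Finset.sum_le_sum fun j _ => ?_
          have : a q j = ((P ^ q) i j - π i) - (u - m * π i) / m := by
            simp only [ha]; field_simp; ring
          rw [this]
          refine (abs_sub _ _).trans ?_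
          rw [abs_div, abs_of_pos hmR]
      _ = ∑ j, |(P ^ q) i j - π i| + |u - m * π i| := by
          rw [Finset.sum_add_distrib, Finset.sum_const, Finset.card_univ, Fintype.card_fin,
            nsmul_eq_mul]
          field_simp
      _ ≤ C * lam ^ q + C * lam ^ t := add_le_add (hC q i) h1
      _ ≤ _ := by nlinarith
  -- In the closed form, subtracting `u` times the mean replaces every coefficient `(P ^ q) i j` by
  -- `a q j`.
  have hdecomp : w t i - u • ((m : ℝ)⁻¹ • ∑ j, w t j) =
      ∑ j, a t j • w 0 j - ∑ s ∈ Finset.range t, γ s • ∑ j, a (t - s) j • g s j := by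
    rw [pushSum_sum_eq hs hw, pushSum_unroll hw]
    simp only [ha, sub_smul, Finset.sum_sub_distrib, smul_sub, ← Finset.smul_sum, smul_smul,
      div_eq_mul_inv]
    simp only [smul_comm (γ _), Finset.smul_sum, smul_smul, mul_comm (γ _)]
    abel
  have hb1 : ‖∑ j, a t j • w 0 j‖ ≤ 2 * C * lam ^ t * (m * W) := by
    have hWm : ∑ j, ‖w 0 j‖ ≤ m * W := by
      rwa [inv_mul_le_iff₀ hmR] at hW
    calc ‖∑ j, a t j • w 0 j‖ ≤ ∑ j, |a t j| * ‖w 0 j‖ := by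
          refine (norm_sum_le _ _).trans (le_of_eq ?_)
          simp [norm_smul]
      _ ≤ ∑ j, 2 * C * lam ^ t * ‖w 0 j‖ := by
          refine Finset.sum_le_sum fun j _ => mul_le_mul_of_nonneg_right ?_ (norm_nonneg _)
          exact (Finset.single_le_sum (f := fun j => |a t j|) (fun _ _ => abs_nonneg _)
            (Finset.mem_univ j)).trans (hrow t le_rfl)
      _ ≤ _ := by
          rw [← Finset.mul_sum]
          exact mul_le_mul_of_nonneg_left hWm (by positivity)
  -- `G` is enlarged to `m G` only to share the factor `m` of the initial term; this factor cancels
  -- against `m δ` in the lower bound for the weight `u`.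
  have hb2 : ∀ s, ‖∑ j, a (t - s) j • g s j‖ ≤ 2 * C * lam ^ (t - s) * (m * G) := by
    intro s
    have hm1 : (1 : ℝ) ≤ m := by exact_mod_cast hm
    calc ‖∑ j, a (t - s) j • g s j‖ ≤ ∑ j, |a (t - s) j| * ‖g s j‖ := by
          refine (norm_sum_le _ _).trans (le_of_eq ?_)
          simp [norm_smul]
      _ ≤ ∑ j, |a (t - s) j| * G :=
          Finset.sum_le_sum fun j _ => mul_le_mul_of_nonneg_left (hg s j) (abs_nonneg _)
      _ ≤ 2 * C * lam ^ (t - s) * G := by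
          rw [← Finset.sum_mul]
          exact mul_le_mul_of_nonneg_right (hrow _ (Nat.sub_le _ _)) hG
      _ ≤ _ := mul_le_mul_of_nonneg_left (by nlinarith) (by positivity)
  have hnorm : ‖w t i - u • ((m : ℝ)⁻¹ • ∑ j, w t j)‖ ≤
      m * (2 * C * (W * lam ^ t + G * ∑ s ∈ Finset.range t, γ s * lam ^ (t - s))) := by
    rw [hdecomp]
    refine (norm_sub_le _ _).trans ?_
    have h3 : ‖∑ s ∈ Finset.range t, γ s • ∑ j, a (t - s) j • g s j‖ ≤
        ∑ s ∈ Finset.range t, γ s * (2 * C * lam ^ (t - s) * (m * G)) := by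
      refine (norm_sum_le _ _).trans (Finset.sum_le_sum fun s _ => ?_)
      rw [norm_smul, Real.norm_of_nonneg (hγ s)]
      exact mul_le_mul_of_nonneg_left (hb2 s) (hγ s)
    refine (add_le_add hb1 h3).trans (le_of_eq ?_)
    rw [mul_add, mul_add]
    congr 1
    · ring
    · simp only [Finset.mul_sum]
      exact Finset.sum_congr rfl fun s _ => by ring
  have hfin : (u)⁻¹ • w t i - (m : ℝ)⁻¹ • ∑ j, w t j =
      u⁻¹ • (w t i - u • ((m : ℝ)⁻¹ • ∑ j, w t j)) := by
    rw [smul_sub, inv_smul_smul₀ hupos.ne']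
  rw [hfin, norm_smul, norm_inv, Real.norm_of_nonneg hupos.le]
  calc u⁻¹ * _ ≤ (m * δ / (C + 1))⁻¹ * _ :=
        mul_le_mul (inv_anti₀ hlow hule) hnorm (norm_nonneg _) (inv_nonneg.mpr hlow.le)
    _ = consensusBound π G W lam C γ t := by
        unfold consensusBound
        rw [← hδdef]
        field_simp

end Consensus

/-! ### Pathwise analysis of SGP -/

section MeanRecursion

variable {m n d : ℕ} {Z : Type u} {P : Matrix (Fin m) (Fin m) ℝ} {γ : ℕ → ℝ}
  {f : EuclideanSpace ℝ (Fin d) → Z → ℝ} {w0 : Fin m → EuclideanSpace ℝ (Fin d)}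

lemma sgpMean_succ (hs : ∀ j, ∑ i, P i j = 1) (hm : 0 < m) (S : Fin m → Fin n → Z)
    (ω : ℕ → Fin m → Fin n) (t : ℕ) :
    sgpMean P γ f w0 S ω (t + 1) = (m : ℝ)⁻¹ • ∑ j, (sgpMean P γ f w0 S ω t - γ t •
      gradient (fun x => f x (S j (ω t j)))
        ((pushWeight P t j)⁻¹ • sgpProxy P γ f w0 S ω t j)) := by
  have hmR : (m : ℝ) ≠ 0 := by exact_mod_cast hm.ne'
  have h := pushSum_mean_succ (w := sgpProxy P γ f w0 S ω) (γ := γ)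
    (g := fun t j => gradient (fun x => f x (S j (ω t j)))
        ((pushWeight P t j)⁻¹ • sgpProxy P γ f w0 S ω t j)) hs (fun t i => rfl) t
  rw [sgpMean, h, Finset.sum_sub_distrib, Finset.sum_sub_distrib, smul_sub, smul_sub,
    Finset.sum_const, Finset.card_univ, Fintype.card_fin, ← Nat.cast_smul_eq_nsmul ℝ, smul_smul,
    inv_mul_cancel₀ hmR, one_smul, sgpMean]

end MeanRecursion

section Pathwise

variable {m n d : ℕ} {Z : Type u} [MeasurableSpace Z]

/-- The standing assumptions on the deterministic data of SGP. -/
structure IsSGPSetting (G L W lam C : ℝ) (P : Matrix (Fin m) (Fin m) ℝ) (π : Fin m → ℝ)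
    (γ : ℕ → ℝ) (f : EuclideanSpace ℝ (Fin d) → Z → ℝ) (w0 : Fin m → EuclideanSpace ℝ (Fin d)) :
    Prop where
  nodes_pos : 0 < m
  G_nonneg : 0 ≤ G
  L_pos : 0 < L
  nonneg : ∀ i j, 0 ≤ P i j
  colStochastic : ∀ j, ∑ i, P i j = 1
  perron : IsPerronVector P π
  lam_nonneg : 0 ≤ lam
  lam_lt_one : lam < 1
  mixing : IsMixingConstant P π lam C
  loss : IsConvexLoss f G L
  step_pos : ∀ t, 0 < γ t
  step_le : ∀ t, γ t ≤ 2 / L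
  init_le : (m : ℝ)⁻¹ * ∑ i, ‖w0 i‖ ≤ W

variable {G L W lam C : ℝ} {P : Matrix (Fin m) (Fin m) ℝ} {π : Fin m → ℝ} {γ : ℕ → ℝ}
  {f : EuclideanSpace ℝ (Fin d) → Z → ℝ} {w0 : Fin m → EuclideanSpace ℝ (Fin d)}

namespace IsSGPSetting

lemma norm_gradient_le (h : IsSGPSetting G L W lam C P π γ f w0) (ξ : Z)
    (x : EuclideanSpace ℝ (Fin d)) : ‖gradient (fun w => f w ξ) x‖ ≤ G :=
  norm_gradient_le_of_lipschitz h.G_nonneg (h.loss.lipschitz ξ) x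

lemma W_nonneg (h : IsSGPSetting G L W lam C P π γ f w0) : 0 ≤ W :=
  (mul_nonneg (by positivity) (Finset.sum_nonneg fun _ _ => norm_nonneg _)).trans h.init_le

lemma bound_nonneg (h : IsSGPSetting G L W lam C P π γ f w0) (t : ℕ) :
    0 ≤ consensusBound π G W lam C γ t :=
  consensusBound_nonneg h.nodes_pos h.perron h.mixing h.lam_nonneg h.G_nonneg h.W_nonneg
    (fun t => (h.step_pos t).le) t

lemma norm_debiased_sub_le (h : IsSGPSetting G L W lam C P π γ f w0) (S : Fin m → Fin n → Z)
    (ω : ℕ → Fin m → Fin n) (t : ℕ) (i : Fin m) :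
    ‖(pushWeight P t i)⁻¹ • sgpProxy P γ f w0 S ω t i - sgpMean P γ f w0 S ω t‖ ≤
      consensusBound π G W lam C γ t :=
  norm_debiased_sub_mean_le (w := sgpProxy P γ f w0 S ω)
    (g := fun t j => gradient (fun x => f x (S j (ω t j)))
        ((pushWeight P t j)⁻¹ • sgpProxy P γ f w0 S ω t j))
    h.nodes_pos h.nonneg h.colStochastic h.perron h.lam_nonneg h.lam_lt_one h.G_nonneg h.mixing
    (fun t => (h.step_pos t).le) (fun _ _ => rfl) (fun _ _ => h.norm_gradient_le _ _) h.init_le t i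

lemma norm_mean_inv_smul_sum_le {E : Type*} [NormedAddCommGroup E] [NormedSpace ℝ E] (hm : 0 < m)
    {x : Fin m → E} {b : Fin m → ℝ} (hx : ∀ j, ‖x j‖ ≤ b j) :
    ‖(m : ℝ)⁻¹ • ∑ j, x j‖ ≤ (m : ℝ)⁻¹ * ∑ j, b j := by
  rw [norm_smul, norm_inv, Real.norm_of_nonneg (Nat.cast_nonneg m)]
  exact mul_le_mul_of_nonneg_left ((norm_sum_le _ _).trans (Finset.sum_le_sum fun j _ => hx j))
    (by positivity)

lemma mean_const (hm : 0 < m) (c : ℝ) : (m : ℝ)⁻¹ * ∑ _j : Fin m, c = c := by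
  have hmR : (m : ℝ) ≠ 0 := by exact_mod_cast hm.ne'
  simp [hmR]

lemma norm_sgpMean_succ_sub_le (h : IsSGPSetting G L W lam C P π γ f w0) (S : Fin m → Fin n → Z)
    (ω : ℕ → Fin m → Fin n) (t : ℕ) :
    ‖sgpMean P γ f w0 S ω (t + 1)‖ ≤ ‖sgpMean P γ f w0 S ω t‖ + γ t * G := by
  rw [sgpMean_succ h.colStochastic h.nodes_pos]
  refine (norm_mean_inv_smul_sum_le h.nodes_pos (b := fun _ => ‖sgpMean P γ f w0 S ω t‖ + γ t * G)
    fun j => ?_).trans (le_of_eq (mean_const h.nodes_pos _))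
  refine (norm_sub_le _ _).trans (add_le_add le_rfl ?_)
  rw [norm_smul, Real.norm_of_nonneg (h.step_pos t).le]
  exact mul_le_mul_of_nonneg_left (h.norm_gradient_le _ _) (h.step_pos t).le

/-- Valid on every sample path. Its growth in `t` is harmless: it is used for integrability, and in
the regret bound only at the starting round `0` or `1`. -/
lemma norm_sgpMean_le (h : IsSGPSetting G L W lam C P π γ f w0) (S : Fin m → Fin n → Z)
    (ω : ℕ → Fin m → Fin n) (t : ℕ) :
    ‖sgpMean P γ f w0 S ω t‖ ≤ W + t * (2 / L * G) := by
  induction t with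
  | zero =>
    have := norm_mean_inv_smul_sum_le h.nodes_pos (x := w0) (fun _ => le_rfl)
    simpa [sgpMean, sgpProxy] using this.trans h.init_le
  | succ t ih =>
    have h1 := h.norm_sgpMean_succ_sub_le S ω t
    have h2 := mul_le_mul_of_nonneg_right (h.step_le t) h.G_nonneg
    push_cast
    linarith

/-- Replacing one sample of the data set: growth of the distance of the consensus models. -/
lemma norm_sgpMean_sub_le (h : IsSGPSetting G L W lam C P π γ f w0) {S S' : Fin m → Fin n → Z}
    (ω : ℕ → Fin m → Fin n) {i : Fin m} {k : Fin n}
    (hS : ∀ j l, (j ≠ i ∨ l ≠ k) → S j l = S' j l) (t : ℕ) :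
    ‖sgpMean P γ f w0 S ω t - sgpMean P γ f w0 S' ω t‖ ≤
      ∑ s ∈ Finset.range t, γ s * (2 * L * consensusBound π G W lam C γ s +
        2 * G / m * if ω s i = k then 1 else 0) := by
  induction t with
  | zero => simp [sgpMean, sgpProxy]
  | succ t ih =>
    rw [Finset.sum_range_succ]
    refine le_trans ?_ (add_le_add ih le_rfl)
    rw [sgpMean_succ h.colStochastic h.nodes_pos, sgpMean_succ h.colStochastic h.nodes_pos,
      ← smul_sub, ← Finset.sum_sub_distrib]
    set x := sgpMean P γ f w0 S ω t with hx
    set y := sgpMean P γ f w0 S' ω t with hy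
    have hγ := (h.step_pos t).le
    set B := consensusBound π G W lam C γ t with hB
    have hsm : ∀ (ξ : Z) (v w : EuclideanSpace ℝ (Fin d)), ‖w - v‖ ≤ B →
        ‖γ t • (gradient (fun x => f x ξ) v - gradient (fun x => f x ξ) w)‖ ≤ γ t * (L * B) := by
      intro ξ v w hvw
      rw [norm_smul, Real.norm_of_nonneg hγ, norm_sub_rev]
      exact mul_le_mul_of_nonneg_left ((h.loss.smooth ξ v w).trans
        (mul_le_mul_of_nonneg_left hvw h.L_pos.le)) hγ
    refine (norm_mean_inv_smul_sum_le h.nodes_pos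
      (b := fun j => (‖x - y‖ + γ t * (2 * L * B)) +
        if j = i then γ t * (2 * G * if ω t i = k then 1 else 0) else 0) fun j => ?_).trans ?_
    · set ξ := S j (ω t j) with hξ
      set ξ' := S' j (ω t j) with hξ'
      set z := (pushWeight P t j)⁻¹ • sgpProxy P γ f w0 S ω t j with hz
      set z' := (pushWeight P t j)⁻¹ • sgpProxy P γ f w0 S' ω t j with hz'
      have h1 := hsm ξ x z (h.norm_debiased_sub_le S ω t j)
      have h2 := hsm ξ' y z' (h.norm_debiased_sub_le S' ω t j)
      -- Four pieces: exact gradient steps for the same loss at `x` and `y`, which are nonexpansive;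
      -- two consensus errors, each at most `γ t * (L * B)`; and the change of the sample, present
      -- only at node `i` in rounds that draw `k`.
      have e : x - γ t • gradient (fun x => f x ξ) z - (y - γ t • gradient (fun x => f x ξ') z') =
          ((x - γ t • gradient (fun x => f x ξ) x) - (y - γ t • gradient (fun x => f x ξ) y)) +
          γ t • (gradient (fun x => f x ξ) x - gradient (fun x => f x ξ) z) -
          γ t • (gradient (fun x => f x ξ') y - gradient (fun x => f x ξ') z') +
          γ t • (gradient (fun x => f x ξ') y - gradient (fun x => f x ξ) y) := by
        simp only [smul_sub]; abel
      have h3 : ‖γ t • (gradient (fun x => f x ξ') y - gradient (fun x => f x ξ) y)‖ ≤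
          if j = i then γ t * (2 * G * if ω t i = k then 1 else 0) else 0 := by
        by_cases hj : j = i ∧ ω t i = k
        · rw [if_pos hj.1, if_pos hj.2, norm_smul, Real.norm_of_nonneg hγ]
          refine mul_le_mul_of_nonneg_left ((norm_sub_le _ _).trans ?_) hγ
          linarith [h.norm_gradient_le ξ y, h.norm_gradient_le ξ' y]
        · have : ξ = ξ' := hS _ _ (by
            by_contra hcon
            push Not at hcon
            exact hj ⟨hcon.1, by rw [← hcon.1]; exact hcon.2⟩)
          rw [this, sub_self, smul_zero, norm_zero]
          have := h.G_nonneg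
          split_ifs <;> positivity
      have h4 := norm_gradient_step_sub_le (h.loss.convex ξ) (h.loss.differentiable ξ) h.L_pos
        (h.loss.smooth ξ) hγ (h.step_le t) y x
      rw [e]
      refine (norm_add_le _ _).trans (add_le_add ?_ h3)
      refine (norm_sub_le _ _).trans ?_
      refine (add_le_add (norm_add_le _ _) le_rfl).trans ?_
      linarith
    · rw [Finset.sum_add_distrib, mul_add, mean_const h.nodes_pos]
      rw [Finset.sum_ite_eq' Finset.univ i, if_pos (Finset.mem_univ _)]
      refine le_of_eq ?_
      ring

/-- One step of the descent of the distance to a reference point. -/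
lemma norm_sgpMean_succ_sub_sq_le (h : IsSGPSetting G L W lam C P π γ f w0)
    (S : Fin m → Fin n → Z) (ω : ℕ → Fin m → Fin n) (v : EuclideanSpace ℝ (Fin d)) (t : ℕ) :
    ‖sgpMean P γ f w0 S ω (t + 1) - v‖ ^ 2 ≤ ‖sgpMean P γ f w0 S ω t - v‖ ^ 2
      - 2 * γ t * ((m : ℝ)⁻¹ * ∑ j, (f (sgpMean P γ f w0 S ω t) (S j (ω t j))
          - f v (S j (ω t j))))
      + 4 * G * (γ t * consensusBound π G W lam C γ t) + G ^ 2 * γ t ^ 2 := by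
  have hmR : (0 : ℝ) < m := by exact_mod_cast h.nodes_pos
  have hγ := (h.step_pos t).le
  rw [sgpMean_succ h.colStochastic h.nodes_pos]
  set x := sgpMean P γ f w0 S ω t with hx
  set B := consensusBound π G W lam C γ t with hB
  set g : Fin m → EuclideanSpace ℝ (Fin d) := fun j => gradient (fun x => f x (S j (ω t j)))
    ((pushWeight P t j)⁻¹ • sgpProxy P γ f w0 S ω t j) with hg
  have e : (m : ℝ)⁻¹ • ∑ j, (x - γ t • g j) - v = (x - v) - γ t • ((m : ℝ)⁻¹ • ∑ j, g j) := by
    rw [Finset.sum_sub_distrib, smul_sub, Finset.sum_const, Finset.card_univ, Fintype.card_fin,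
      ← Nat.cast_smul_eq_nsmul ℝ, smul_smul, inv_mul_cancel₀ hmR.ne', one_smul, ← Finset.smul_sum,
      smul_comm (m : ℝ)⁻¹]
    abel
  have hnorm : ‖(m : ℝ)⁻¹ • ∑ j, g j‖ ≤ G :=
    (norm_mean_inv_smul_sum_le h.nodes_pos (b := fun _ => G)
      fun j => h.norm_gradient_le _ _).trans (le_of_eq (mean_const h.nodes_pos _))
  -- Convexity is used at the de-biased point `z`, where the gradient is taken. Returning from `z`
  -- to `x` costs `G B` in the loss and `G B` in the inner product.
  have hinner : ∀ j, f x (S j (ω t j)) - f v (S j (ω t j)) - 2 * G * B ≤ inner ℝ (x - v) (g j) := by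
    intro j
    set ξ := S j (ω t j) with hξ
    set z := (pushWeight P t j)⁻¹ • sgpProxy P γ f w0 S ω t j with hz
    have hzx : ‖z - x‖ ≤ B := h.norm_debiased_sub_le S ω t j
    have h1 := (h.loss.convex ξ).add_inner_gradient_le (h.loss.differentiable ξ) z v
    have h2 : f x ξ - f z ξ ≤ G * B := by
      refine (le_abs_self _).trans ((h.loss.lipschitz ξ z x).trans ?_)
      rw [norm_sub_rev]
      exact mul_le_mul_of_nonneg_left hzx h.G_nonneg
    have h3 : |inner ℝ (g j) (z - x)| ≤ G * B :=
      (abs_real_inner_le_norm _ _).trans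
        (mul_le_mul (h.norm_gradient_le _ _) hzx (norm_nonneg _) h.G_nonneg)
    have h4 : inner ℝ (x - v) (g j) = - inner ℝ (g j) (v - z) - inner ℝ (g j) (z - x) := by
      rw [real_inner_comm, ← inner_neg_right, ← inner_sub_right]
      congr 1
      abel
    have h5 := (abs_le.mp h3).2
    change f z ξ + inner ℝ (g j) (v - z) ≤ f v ξ at h1
    linarith
  have hsum : (m : ℝ)⁻¹ * ∑ j, (f x (S j (ω t j)) - f v (S j (ω t j))) - 2 * G * B ≤
      inner ℝ (x - v) ((m : ℝ)⁻¹ • ∑ j, g j) := by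
    rw [real_inner_smul_right, inner_sum]
    have h1 := mul_le_mul_of_nonneg_left (Finset.sum_le_sum fun j (_ : j ∈ Finset.univ) => hinner j)
      (inv_nonneg.mpr hmR.le)
    rwa [Finset.sum_sub_distrib (f := fun j => f x (S j (ω t j)) - f v (S j (ω t j))), mul_sub,
      mean_const h.nodes_pos] at h1
  rw [e, norm_sub_sq_real, real_inner_smul_right, norm_smul, mul_pow, Real.norm_of_nonneg hγ]
  have h1 := mul_le_mul_of_nonneg_left hsum hγ
  have h2 : γ t ^ 2 * ‖(m : ℝ)⁻¹ • ∑ j, g j‖ ^ 2 ≤ γ t ^ 2 * G ^ 2 :=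
    mul_le_mul_of_nonneg_left (pow_le_pow_left₀ (norm_nonneg _) hnorm 2) (sq_nonneg _)
  linarith

/-- The weighted regret of the consensus models against a reference point. -/
lemma sum_regret_le (h : IsSGPSetting G L W lam C P π γ f w0)
    (S : Fin m → Fin n → Z) (ω : ℕ → Fin m → Fin n) {v : EuclideanSpace ℝ (Fin d)} {r : ℝ}
    (hv : ‖v‖ ≤ r) {s : ℕ} (hs : s ≤ 1) (T : ℕ) :
    ∑ t ∈ Finset.Ico s (s + T), γ t * ((m : ℝ)⁻¹ * ∑ j, (f (sgpMean P γ f w0 S ω t) (S j (ω t j))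
          - f v (S j (ω t j)))) ≤
      (W + 2 / L * G + r) ^ 2 / 2 +
        ∑ t ∈ Finset.range (s + T), (2 * G * (γ t * consensusBound π G W lam C γ t)
          + G ^ 2 / 2 * γ t ^ 2) := by
  have key : ∀ T, ∑ t ∈ Finset.Ico s (s + T), γ t * ((m : ℝ)⁻¹ * ∑ j,
        (f (sgpMean P γ f w0 S ω t) (S j (ω t j)) - f v (S j (ω t j)))) ≤
      ‖sgpMean P γ f w0 S ω s - v‖ ^ 2 / 2 - ‖sgpMean P γ f w0 S ω (s + T) - v‖ ^ 2 / 2 +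
        ∑ t ∈ Finset.Ico s (s + T), (2 * G * (γ t * consensusBound π G W lam C γ t)
          + G ^ 2 / 2 * γ t ^ 2) := by
    intro T
    induction T with
    | zero => simp
    | succ T ih =>
      rw [← add_assoc, Finset.sum_Ico_succ_top (by omega), Finset.sum_Ico_succ_top (by omega)]
      have := h.norm_sgpMean_succ_sub_sq_le S ω v (s + T)
      linarith
  refine (key T).trans (add_le_add ?_ ?_)
  -- An average started at round `1` begins after one step of length at most `2 / L * G`.
  · have h1 : ‖sgpMean P γ f w0 S ω s - v‖ ≤ W + 2 / L * G + r := by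
      refine (norm_sub_le _ _).trans (add_le_add ((h.norm_sgpMean_le S ω s).trans ?_) hv)
      have h2 : (s : ℝ) ≤ 1 := by exact_mod_cast hs
      have h3 : 0 ≤ 2 / L * G := mul_nonneg (div_nonneg zero_le_two h.L_pos.le) h.G_nonneg
      nlinarith
    have h2 := pow_le_pow_left₀ (norm_nonneg _) h1 2
    have h3 := sq_nonneg ‖sgpMean P γ f w0 S ω (s + T) - v‖
    linarith
  · refine Finset.sum_le_sum_of_subset_of_nonneg ?_ fun t _ _ => ?_
    · intro t ht
      exact Finset.mem_range.mpr (Finset.mem_Ico.mp ht).2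
    · have := h.bound_nonneg t
      have := h.G_nonneg
      have := (h.step_pos t).le
      positivity

/-! #### The averaged output -/

lemma sum_step_pos (h : IsSGPSetting G L W lam C P π γ f w0) (s : ℕ) {T : ℕ} (hT : 0 < T) :
    0 < ∑ t ∈ Finset.Ico s (s + T), γ t :=
  Finset.sum_pos (fun t _ => h.step_pos t) (Finset.nonempty_Ico.mpr (by omega))

/-- Jensen's inequality for the averaged output. -/
lemma loss_sgpOutput_le (h : IsSGPSetting G L W lam C P π γ f w0) (s : ℕ) {T : ℕ} (hT : 0 < T)
    (S : Fin m → Fin n → Z) (ω : ℕ → Fin m → Fin n) (ξ : Z) :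
    f (sgpOutput P γ f w0 s T S ω) ξ ≤ (∑ t ∈ Finset.Ico s (s + T), γ t)⁻¹ *
      ∑ t ∈ Finset.Ico s (s + T), γ t * f (sgpMean P γ f w0 S ω t) ξ := by
  have := (h.loss.convex ξ).map_centerMass_le (t := Finset.Ico s (s + T)) (w := γ)
    (p := sgpMean P γ f w0 S ω) (fun t _ => (h.step_pos t).le) (h.sum_step_pos s hT)
    (fun _ _ => Set.mem_univ _)
  simpa [Finset.centerMass, sgpOutput] using this

lemma norm_weighted_le {E : Type*} [NormedAddCommGroup E] [NormedSpace ℝ E] {I : Finset ℕ}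
    {x : ℕ → E} {b : ℝ} (hγ : ∀ t, 0 < γ t) (hI : 0 < ∑ t ∈ I, γ t) (hx : ∀ t ∈ I, ‖x t‖ ≤ b) :
    ‖(∑ t ∈ I, γ t)⁻¹ • ∑ t ∈ I, γ t • x t‖ ≤ b := by
  rw [norm_smul, norm_inv, Real.norm_of_nonneg hI.le, inv_mul_le_iff₀ hI, Finset.sum_mul]
  refine (norm_sum_le _ _).trans (Finset.sum_le_sum fun t ht => ?_)
  rw [norm_smul, Real.norm_of_nonneg (hγ t).le]
  exact mul_le_mul_of_nonneg_left (hx t ht) (hγ t).le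

lemma norm_sgpOutput_le (h : IsSGPSetting G L W lam C P π γ f w0) (s : ℕ) {T : ℕ} (hT : 0 < T)
    (S : Fin m → Fin n → Z) (ω : ℕ → Fin m → Fin n) :
    ‖sgpOutput P γ f w0 s T S ω‖ ≤ W + (s + T : ℕ) * (2 / L * G) := by
  refine norm_weighted_le h.step_pos (h.sum_step_pos s hT) fun t ht =>
    (h.norm_sgpMean_le S ω t).trans ?_
  have : (t : ℝ) ≤ (s + T : ℕ) := by exact_mod_cast (Finset.mem_Ico.mp ht).2.le
  have h3 : 0 ≤ 2 / L * G := mul_nonneg (div_nonneg zero_le_two h.L_pos.le) h.G_nonneg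
  nlinarith

/-- Stability of the output under the replacement of one sample. -/
lemma norm_sgpOutput_sub_le (h : IsSGPSetting G L W lam C P π γ f w0) (s : ℕ) {T : ℕ}
    (hT : 0 < T) {S S' : Fin m → Fin n → Z} (ω : ℕ → Fin m → Fin n) {i : Fin m} {k : Fin n}
    (hS : ∀ j l, (j ≠ i ∨ l ≠ k) → S j l = S' j l) :
    ‖sgpOutput P γ f w0 s T S ω - sgpOutput P γ f w0 s T S' ω‖ ≤
      ∑ t ∈ Finset.range (s + T), γ t * (2 * L * consensusBound π G W lam C γ t +
        2 * G / m * if ω t i = k then 1 else 0) := by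
  rw [sgpOutput, sgpOutput, ← smul_sub, ← Finset.sum_sub_distrib]
  simp only [← smul_sub]
  refine norm_weighted_le h.step_pos (h.sum_step_pos s hT) fun t ht =>
    (h.norm_sgpMean_sub_le ω hS t).trans ?_
  refine Finset.sum_le_sum_of_subset_of_nonneg ?_ fun t _ _ => ?_
  · exact Finset.range_subset_range.mpr (Finset.mem_Ico.mp ht).2.le
  · have := h.bound_nonneg t
    have := h.G_nonneg
    have := (h.step_pos t).le
    have := h.L_pos
    split_ifs <;> positivity

end IsSGPSetting

end Pathwise

/-! ### Resampling one coordinate of a product measure -/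

section Resampling

/-- Replacing a component of `x` by an independent sample `z` through `upd` preserves the law of
`x`. -/
structure IsResampling {X Z : Type*} [MeasurableSpace X] [MeasurableSpace Z] (Q : Measure X)
    (D : Measure Z) (upd : X → Z → X) : Prop where
  measurable : Measurable (fun p : X × Z => upd p.1 p.2)
  lintegral_eq : ∀ g : X → ENNReal, Measurable g → ∫⁻ x, ∫⁻ z, g (upd x z) ∂D ∂Q = ∫⁻ x, g x ∂Q

variable {X Y Z : Type*} [MeasurableSpace X] [MeasurableSpace Y] [MeasurableSpace Z]

lemma isResampling_id (D : Measure Z) [IsProbabilityMeasure D] :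
    IsResampling D D (fun _ z => z) where
  measurable := measurable_snd
  lintegral_eq g _ := by simp

/-- Product measures are determined on boxes; the preimage of a box is the box with its `i`-th side
freed, times that side in the new variable. -/
lemma measurePreserving_update {ι : Type*} [Fintype ι] [DecidableEq ι] {X : ι → Type*}
    [∀ i, MeasurableSpace (X i)] (μ : ∀ i, Measure (X i)) [∀ i, IsProbabilityMeasure (μ i)]
    (i : ι) : MeasurePreserving (fun p : (∀ i, X i) × X i => Function.update p.1 i p.2)
      ((Measure.pi μ).prod (μ i)) (Measure.pi μ) := by
  have hmeas : Measurable (fun p : (∀ i, X i) × X i => Function.update p.1 i p.2) :=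
    measurable_update'
  refine ⟨hmeas, (Measure.pi_eq fun s hs => ?_).symm⟩
  rw [Measure.map_apply hmeas (MeasurableSet.univ_pi hs)]
  have : (fun p : (∀ i, X i) × X i => Function.update p.1 i p.2) ⁻¹' Set.univ.pi s =
      (Set.univ.pi (Function.update s i Set.univ)) ×ˢ s i := by
    ext ⟨x, z⟩
    simp only [Set.mem_preimage, Set.mem_univ_pi, Set.mem_prod]
    constructor
    · intro h
      refine ⟨fun j => ?_, by simpa using h i⟩
      rcases eq_or_ne j i with rfl | hj
      · simp
      · simpa [hj] using h j
    · rintro ⟨h1, h2⟩ j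
      rcases eq_or_ne j i with rfl | hj
      · simpa using h2
      · simpa [hj] using h1 j
  rw [this, Measure.prod_prod, Measure.pi_pi, ← Finset.mul_prod_erase _ _ (Finset.mem_univ i),
    ← Finset.mul_prod_erase (a := i) _ (fun i => μ i (s i)) (Finset.mem_univ i),
    Function.update_self, measure_univ, one_mul, mul_comm]
  congr 1
  refine Finset.prod_congr rfl fun j hj => ?_
  rw [Function.update_of_ne (Finset.ne_of_mem_erase hj)]

/-- Resampling the whole coordinate `i` first turns that coordinate into an explicit integration
variable, to which the hypothesis on the factor applies. -/
lemma IsResampling.pi {ι : Type*} [Fintype ι] [DecidableEq ι] {X : ι → Type*}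
    [∀ i, MeasurableSpace (X i)] {μ : ∀ i, Measure (X i)} [∀ i, IsProbabilityMeasure (μ i)]
    {D : Measure Z} [IsProbabilityMeasure D] {i : ι} {upd : X i → Z → X i}
    (h : IsResampling (μ i) D upd) :
    IsResampling (Measure.pi μ) D (fun x z => Function.update x i (upd (x i) z)) := by
  have hup : Measurable (fun p : (∀ i, X i) × X i => Function.update p.1 i p.2) :=
    measurable_update'
  have hM : Measurable (fun p : (∀ i, X i) × Z => Function.update p.1 i (upd (p.1 i) p.2)) :=
    hup.comp (measurable_fst.prodMk
      (h.measurable.comp (((measurable_pi_apply i).comp measurable_fst).prodMk measurable_snd)))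
  have hU : ∀ g : (∀ i, X i) → ENNReal, Measurable g →
      ∫⁻ x, ∫⁻ y, g (Function.update x i y) ∂(μ i) ∂(Measure.pi μ) = ∫⁻ x, g x ∂(Measure.pi μ) := by
    intro g hg
    rw [← (measurePreserving_update μ i).lintegral_comp hg]
    exact (lintegral_prod (fun p : (∀ i, X i) × X i => g (Function.update p.1 i p.2))
      (hg.comp hup).aemeasurable).symm
  refine ⟨hM, fun g hg => ?_⟩
  have hg' : Measurable fun x => ∫⁻ z, g (Function.update x i (upd (x i) z)) ∂D :=
    (hg.comp hM).lintegral_prod_right'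
  rw [← hU _ hg', ← hU g hg]
  refine lintegral_congr fun x => ?_
  simp only [Function.update_self, Function.update_idem]
  exact h.lintegral_eq (fun y => g (Function.update x i y)) (hg.comp (measurable_update x))

lemma IsResampling.prod {Q : Measure X} [SFinite Q] {D : Measure Z} [SFinite D]
    {upd : X → Z → X} (h : IsResampling Q D upd) (R : Measure Y) [SFinite R] :
    IsResampling (Q.prod R) D (fun p z => (upd p.1 z, p.2)) := by
  have hM : Measurable (fun p : (X × Y) × Z => (upd p.1.1 p.2, p.1.2)) :=
    (h.measurable.comp ((measurable_fst.comp measurable_fst).prodMk measurable_snd)).prodMk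
      (measurable_snd.comp measurable_fst)
  refine ⟨hM, fun g hg => ?_⟩
  have hgM : Measurable fun p : (X × Y) × Z => g (upd p.1.1 p.2, p.1.2) := hg.comp hM
  rw [lintegral_prod _ (Measurable.lintegral_prod_right' hgM).aemeasurable,
    lintegral_prod _ hg.aemeasurable, ← h.lintegral_eq _ hg.lintegral_prod_right']
  refine lintegral_congr fun x => ?_
  refine lintegral_lintegral_swap (f := fun y z => g (upd x z, y)) ?_
  exact (hg.comp ((h.measurable.comp (measurable_const.prodMk measurable_snd)).prodMk
    measurable_fst)).aemeasurable

/-- Exchanging a component with an independent copy preserves the joint law. -/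
lemma IsResampling.measurePreserving_swap {Q : Measure X} [SFinite Q] {D : Measure Z} [SFinite D]
    {upd : X → Z → X} (h : IsResampling Q D upd) {e : X → Z} (he : Measurable e)
    (h1 : ∀ x z, e (upd x z) = z) (h2 : ∀ x y z, upd (upd x y) z = upd x z) :
    MeasurePreserving (fun p : X × Z => (upd p.1 p.2, e p.1)) (Q.prod D) (Q.prod D) := by
  have hM : Measurable (fun p : X × Z => (upd p.1 p.2, e p.1)) :=
    h.measurable.prodMk (he.comp measurable_fst)
  refine ⟨hM, Measure.ext_of_lintegral _ fun g hg => ?_⟩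
  have hgM : Measurable fun p : X × Z => g (upd p.1 p.2, e p.1) := hg.comp hM
  -- Both integrals are resampled once more, so that the stored component becomes a variable `y`
  -- next to `z`. The map then merely exchanges `y` and `z`, and Tonelli concludes.
  rw [lintegral_map hg hM, lintegral_prod _ hgM.aemeasurable,
    lintegral_prod _ hg.aemeasurable, ← h.lintegral_eq _ hgM.lintegral_prod_right',
    ← h.lintegral_eq _ hg.lintegral_prod_right']
  refine lintegral_congr fun x => ?_
  simp only [h1, h2]
  refine lintegral_lintegral_swap (f := fun y z => g (upd x z, y)) ?_
  exact (hg.comp ((h.measurable.comp (measurable_const.prodMk measurable_snd)).prodMk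
    measurable_fst)).aemeasurable

end Resampling

/-! ### Measurability of SGP -/

section Measurability

variable {m n d : ℕ} {Z : Type u} [MeasurableSpace Z] {G L : ℝ}
  {f : EuclideanSpace ℝ (Fin d) → Z → ℝ} {P : Matrix (Fin m) (Fin m) ℝ} {γ : ℕ → ℝ}
  {w0 : Fin m → EuclideanSpace ℝ (Fin d)}

lemma IsConvexLoss.measurable_loss (hf : IsConvexLoss f G L) :
    Measurable (fun p : EuclideanSpace ℝ (Fin d) × Z => f p.1 p.2) :=
  measurable_uncurry_of_continuous_of_measurable
    (fun ξ => (hf.differentiable ξ).continuous) hf.measurable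

/-- Joint measurability of a Carathéodory function: the gradient is continuous in the parameter by
smoothness, and measurable in the sample because its coordinates are limits of difference quotients.
-/
lemma IsConvexLoss.measurable_gradient (hf : IsConvexLoss f G L) (hL : 0 < L) :
    Measurable (fun p : EuclideanSpace ℝ (Fin d) × Z => gradient (fun w => f w p.2) p.1) := by
  refine measurable_uncurry_of_continuous_of_measurable
    (u := fun w ξ => gradient (fun w => f w ξ) w) (fun ξ => ?_) (fun w => ?_)
  · have : LipschitzWith ⟨L, hL.le⟩ (gradient (fun w => f w ξ)) :=
      LipschitzWith.of_dist_le_mul fun x y => by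
        rw [dist_eq_norm, dist_eq_norm]; exact hf.smooth ξ y x
    exact this.continuous
  · refine (MeasurableEquiv.toLp 2 (Fin d → ℝ)).symm.measurableEmbedding.measurable_comp_iff.mp ?_
    refine measurable_pi_iff.mpr fun i => ?_
    set v : EuclideanSpace ℝ (Fin d) := EuclideanSpace.single i 1 with hv
    have hcoord : ∀ ξ, (gradient (fun w => f w ξ) w) i =
        inner ℝ (gradient (fun w => f w ξ) (w + (0 : ℝ) • v)) v := by
      intro ξ
      rw [zero_smul, add_zero, hv, EuclideanSpace.inner_single_right]
      simp
    have hlim : ∀ ξ, Filter.Tendsto (fun N : ℕ => ((N : ℝ) + 1) *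
        (f (w + ((1 : ℝ) / ((N : ℝ) + 1)) • v) ξ - f w ξ)) Filter.atTop
        (nhds ((gradient (fun w => f w ξ) w) i)) := by
      intro ξ
      rw [hcoord]
      have h1 := (hasDerivAt_comp_line (hf.differentiable ξ) w v 0).tendsto_slope_zero_right
      have h2 : Filter.Tendsto (fun N : ℕ => (1 : ℝ) / ((N : ℝ) + 1)) Filter.atTop
          (nhdsWithin 0 (Set.Ioi 0)) :=
        tendsto_nhdsWithin_iff.mpr ⟨tendsto_one_div_add_atTop_nhds_zero_nat,
          Filter.Eventually.of_forall fun N => Set.mem_Ioi.mpr Nat.one_div_pos_of_nat⟩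
      refine (h1.comp h2).congr fun N => ?_
      simp
    refine measurable_of_tendsto_metrizable (f := fun (N : ℕ) ξ => ((N : ℝ) + 1) *
        (f (w + ((1 : ℝ) / ((N : ℝ) + 1)) • v) ξ - f w ξ)) (fun N => ?_)
        (tendsto_pi_nhds.mpr hlim)
    exact ((hf.measurable _).sub (hf.measurable _)).const_mul _

lemma measurable_sample (j : Fin m) (t : ℕ) :
    Measurable (fun p : (Fin m → Fin n → Z) × (ℕ → Fin m → Fin n) => p.1 j (p.2 t j)) := by
  have h : Measurable (fun q : (Fin m → Fin n → Z) × Fin n => q.1 j q.2) :=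
    measurable_from_prod_countable_left fun k =>
      (measurable_pi_apply k).comp (measurable_pi_apply j)
  exact h.comp (measurable_fst.prodMk (by fun_prop))

lemma measurable_sgpProxy (hf : IsConvexLoss f G L) (hL : 0 < L) (t : ℕ) (i : Fin m) :
    Measurable (fun p : (Fin m → Fin n → Z) × (ℕ → Fin m → Fin n) =>
      sgpProxy P γ f w0 p.1 p.2 t i) := by
  induction t generalizing i with
  | zero => exact measurable_const
  | succ t ih =>
    refine Finset.measurable_sum _ fun j _ =>
      ((ih j).sub (Measurable.fun_const_smul ?_ _)).fun_const_smul _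
    exact (hf.measurable_gradient hL).comp
      (((ih j).fun_const_smul _).prodMk (measurable_sample j t))

lemma measurable_sgpMean (hf : IsConvexLoss f G L) (hL : 0 < L) (t : ℕ) :
    Measurable (fun p : (Fin m → Fin n → Z) × (ℕ → Fin m → Fin n) =>
      sgpMean P γ f w0 p.1 p.2 t) :=
  (Finset.measurable_sum _ fun i _ => measurable_sgpProxy hf hL t i).fun_const_smul _

lemma measurable_sgpOutput (hf : IsConvexLoss f G L) (hL : 0 < L) (s T : ℕ) :
    Measurable (fun p : (Fin m → Fin n → Z) × (ℕ → Fin m → Fin n) =>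
      sgpOutput P γ f w0 s T p.1 p.2) :=
  (Finset.measurable_sum _ fun t _ => (measurable_sgpMean hf hL t).fun_const_smul _).fun_const_smul _

end Measurability

/-! ### Independence of the sample indices -/

section Indices

variable {m n d : ℕ} {Z : Type u} {f : EuclideanSpace ℝ (Fin d) → Z → ℝ}
  {P : Matrix (Fin m) (Fin m) ℝ} {γ : ℕ → ℝ} {w0 : Fin m → EuclideanSpace ℝ (Fin d)}

/-- The iterate of round `t` depends only on the indices of the earlier rounds. -/
lemma sgpProxy_congr (S : Fin m → Fin n → Z) {ω ω' : ℕ → Fin m → Fin n} {t : ℕ}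
    (h : ∀ s < t, ω s = ω' s) : sgpProxy P γ f w0 S ω t = sgpProxy P γ f w0 S ω' t := by
  induction t with
  | zero => rfl
  | succ t ih =>
    funext i
    rw [sgpProxy, sgpProxy, ih fun s hs => h s (by omega), h t (by omega)]

lemma sgpMean_congr (S : Fin m → Fin n → Z) {ω ω' : ℕ → Fin m → Fin n} {t : ℕ}
    (h : ∀ s < t, ω s = ω' s) : sgpMean P γ f w0 S ω t = sgpMean P γ f w0 S ω' t := by
  rw [sgpMean, sgpMean, sgpProxy_congr S h]

variable {ν : Measure (Fin m → Fin n)} [IsProbabilityMeasure ν]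

/-- `φ` is a function of finitely many rounds before `t`, hence independent of round `t`, where the
index equals `k` with probability `1 / n`. -/
lemma integral_indicator_mul_eq (hν : ∀ i k, ν {x | x i = k} = (n : ENNReal)⁻¹) {t : ℕ}
    {φ : (ℕ → Fin m → Fin n) → ℝ} (hφ : ∀ ω ω', (∀ s < t, ω s = ω' s) → φ ω = φ ω')
    (j : Fin m) (k : Fin n) :
    ∫ ω, (if ω t j = k then 1 else 0) * φ ω ∂(Measure.infinitePi fun _ : ℕ => ν) =
      (n : ℝ)⁻¹ * ∫ ω, φ ω ∂(Measure.infinitePi fun _ : ℕ => ν) := by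
  have hmeas1 : Measurable (fun x : Fin m → Fin n => if x j = k then (1 : ℝ) else 0) :=
    measurable_of_countable _
  -- The histories before `t` form a countable space, so `ψ` is measurable without any assumption on
  -- `φ`. The rounds from `t` on are filled with the value `k`, which `φ` does not see.
  set ψ : ((Finset.range t) → Fin m → Fin n) → ℝ := fun r =>
    φ fun s => if h : s ∈ Finset.range t then r ⟨s, h⟩ else fun _ => k with hψ
  have hmeas2 : Measurable ψ := measurable_of_countable _
  have hφψ : ∀ ω, φ ω = ψ fun s => ω s := by
    intro ω
    refine hφ _ _ fun s hs => ?_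
    simp [hs]
  have hind := (ProbabilityTheory.iIndepFun_infinitePi (P := fun _ : ℕ => ν)
    (X := fun _ x => x) (fun _ => measurable_id)).indepFun_finset {t} (Finset.range t)
    (by simp) (fun i => measurable_pi_apply i)
  have hind2 := hind.comp (φ := fun r => if r ⟨t, by simp⟩ j = k then (1 : ℝ) else 0) (ψ := ψ)
    (measurable_of_countable _) hmeas2
  have hmeval : Measurable (fun ω : ℕ → Fin m → Fin n => if ω t j = k then (1 : ℝ) else 0) :=
    hmeas1.comp (measurable_pi_apply t)
  have hrestr : Measurable (fun (ω : ℕ → Fin m → Fin n) (s : Finset.range t) => ω s) :=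
    measurable_pi_lambda _ fun s => measurable_pi_apply (s : ℕ)
  have hint := ProbabilityTheory.IndepFun.integral_fun_mul_eq_mul_integral hind2
    hmeval.aestronglyMeasurable
    (hmeas2.comp hrestr).aestronglyMeasurable
  have hone : ∫ ω : ℕ → Fin m → Fin n, (if ω t j = k then (1 : ℝ) else 0)
      ∂(Measure.infinitePi fun _ : ℕ => ν) = (n : ℝ)⁻¹ := by
    have h1 := (measurePreserving_eval_infinitePi (fun _ : ℕ => ν) t)
    rw [← integral_map (φ := Function.eval t) (μ := Measure.infinitePi fun _ : ℕ => ν)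
      (f := fun x => if x j = k then (1 : ℝ) else 0) (measurable_pi_apply t).aemeasurable
      hmeas1.aestronglyMeasurable, h1.map_eq]
    have h2 : (fun x : Fin m → Fin n => if x j = k then (1 : ℝ) else 0) =
        Set.indicator {x | x j = k} 1 := by
      ext x; simp [Set.indicator_apply]
    rw [h2, integral_indicator_one (Set.toFinite _).measurableSet, measureReal_def, hν]
    simp
  simp only [hφψ]
  rw [← hone]
  exact hint

end Indices

/-! ### Expected excess risk -/

section Integrability

variable {d : ℕ} {Z : Type u} [MeasurableSpace Z] {G L : ℝ}
  {f : EuclideanSpace ℝ (Fin d) → Z → ℝ}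

/-- The Lipschitz bound dominates the loss by `|f 0 ζ| + G b`, whose first term is integrable since
`ζ` has law `ρ`. -/
lemma integrable_loss_comp {Ω : Type*} [MeasurableSpace Ω] {μ : Measure Ω} [IsFiniteMeasure μ]
    (hf : IsConvexLoss f G L) (hG : 0 ≤ G) {ρ : Measure Z} (hint : ∀ w, Integrable (f w) ρ)
    {X : Ω → EuclideanSpace ℝ (Fin d)} (hX : Measurable X) {b : ℝ} (hb : ∀ p, ‖X p‖ ≤ b)
    {ζ : Ω → Z} (hζ : MeasurePreserving ζ μ ρ) : Integrable (fun p => f (X p) (ζ p)) μ := by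
  refine Integrable.mono' (g := fun p => |f 0 (ζ p)| + G * b)
    ((hζ.integrable_comp_of_integrable (hint 0)).abs.add (integrable_const _))
    (hf.measurable_loss.comp (hX.prodMk hζ.measurable)).aestronglyMeasurable
    (Filter.Eventually.of_forall fun p => ?_)
  have h1 := hf.lipschitz (ζ p) 0 (X p)
  rw [sub_zero] at h1
  have h2 := mul_le_mul_of_nonneg_left (hb p) hG
  have h3 := abs_sub_abs_le_abs_sub (f (X p) (ζ p)) (f 0 (ζ p))
  rw [Real.norm_eq_abs]
  linarith

end Integrability

section Expectation

variable {m n d : ℕ} {Z : Type u} [MeasurableSpace Z]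
  {G L W lam C : ℝ} {P : Matrix (Fin m) (Fin m) ℝ} {π : Fin m → ℝ} {γ : ℕ → ℝ}
  {f : EuclideanSpace ℝ (Fin d) → Z → ℝ} {w0 : Fin m → EuclideanSpace ℝ (Fin d)}
  {D : Fin m → Measure Z} [∀ i, IsProbabilityMeasure (D i)]
  {ν : Measure (Fin m → Fin n)} [IsProbabilityMeasure ν]

instance : IsProbabilityMeasure (runLaw n D ν) := by
  unfold runLaw; infer_instance

lemma measurePreserving_sample (i : Fin m) (k : Fin n) :
    MeasurePreserving (fun p : (Fin m → Fin n → Z) × (ℕ → Fin m → Fin n) => p.1 i k)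
      (runLaw n D ν) (D i) :=
  (measurePreserving_eval (fun _ : Fin n => D i) k).comp
    ((measurePreserving_eval (fun i => Measure.pi fun _ : Fin n => D i) i).comp
      measurePreserving_fst)

/-- Evaluating the loss at the sampled index amounts on average to the empirical mean. -/
lemma integrable_and_integral_loss_index (hf : IsConvexLoss f G L) (hG : 0 ≤ G)
    (hint : ∀ w i, Integrable (f w) (D i))
    (hν : ∀ i k, ν {x | x i = k} = (n : ENNReal)⁻¹)
    {X : (Fin m → Fin n → Z) × (ℕ → Fin m → Fin n) → EuclideanSpace ℝ (Fin d)}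
    (hX : Measurable X) {b : ℝ} (hb : ∀ p, ‖X p‖ ≤ b) {t : ℕ}
    (hdep : ∀ S ω ω', (∀ s < t, ω s = ω' s) → X (S, ω) = X (S, ω')) (j : Fin m) :
    Integrable (fun p => f (X p) (p.1 j (p.2 t j))) (runLaw n D ν) ∧
    ∫ p, f (X p) (p.1 j (p.2 t j)) ∂(runLaw n D ν) =
      (n : ℝ)⁻¹ * ∑ k, ∫ p, f (X p) (p.1 j k) ∂(runLaw n D ν) := by
  have hφ : ∀ k, Integrable (fun p => f (X p) (p.1 j k)) (runLaw n D ν) := fun k =>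
    integrable_loss_comp hf hG (fun w => hint w j) hX hb (measurePreserving_sample j k)
  have hite : ∀ k, Measurable (fun p : (Fin m → Fin n → Z) × (ℕ → Fin m → Fin n) =>
      if p.2 t j = k then (1 : ℝ) else 0) := fun k => by
    have h1 : Measurable (fun x : Fin n => if x = k then (1 : ℝ) else 0) :=
      measurable_of_countable _
    have h2 : Measurable (fun p : (Fin m → Fin n → Z) × (ℕ → Fin m → Fin n) => p.2 t j) :=
      (measurable_pi_apply j).comp ((measurable_pi_apply t).comp measurable_snd)
    exact h1.comp h2
  have hint' : ∀ k, Integrable (fun p => (if p.2 t j = k then (1 : ℝ) else 0) * f (X p) (p.1 j k))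
      (runLaw n D ν) := fun k => by
    refine (hφ k).mono ((hite k).aestronglyMeasurable.mul (hφ k).aestronglyMeasurable)
      (Filter.Eventually.of_forall fun p => ?_)
    rw [norm_mul]
    split_ifs <;> simp
  -- Splitting over the value of the index leaves, for fixed data, a product of the indicator of
  -- round `t` and a function of the earlier rounds.
  have hdecomp : (fun p : (Fin m → Fin n → Z) × (ℕ → Fin m → Fin n) =>
      f (X p) (p.1 j (p.2 t j))) =
      fun p => ∑ k, (if p.2 t j = k then (1 : ℝ) else 0) * f (X p) (p.1 j k) := by
    funext p
    simp
  rw [hdecomp]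
  refine ⟨integrable_finsetSum _ fun k _ => hint' k, ?_⟩
  rw [integral_finsetSum _ fun k _ => hint' k, Finset.mul_sum]
  refine Finset.sum_congr rfl fun k _ => ?_
  have h1 := hint' k
  have h2 := hφ k
  unfold runLaw at h1 h2 ⊢
  rw [integral_prod _ h1, integral_prod _ h2, ← integral_const_mul]
  refine integral_congr_ae (Filter.Eventually.of_forall fun S => ?_)
  exact integral_indicator_mul_eq (φ := fun ω => f (X (S, ω)) (S j k)) hν
    (fun ω ω' hω => by simp only [hdep S ω ω' hω]) j k

/-- Replacing the sample `k` of node `i` by an independent copy preserves the law of the run. -/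
lemma isResampling_runLaw (i : Fin m) (k : Fin n) :
    IsResampling (runLaw n D ν) (D i) (fun p z =>
      (Function.update p.1 i (Function.update (p.1 i) k z), p.2)) :=
  ((IsResampling.pi (μ := fun _ : Fin n => D i) (isResampling_id (D i))).pi
    (μ := fun i => Measure.pi fun _ : Fin n => D i)).prod _

namespace IsSGPSetting

/-- Generalization by stability, for one sample. -/
lemma integral_loss_fresh_le (h : IsSGPSetting G L W lam C P π γ f w0)
    (hint : ∀ w i, Integrable (f w) (D i)) (hν : ∀ i k, ν {x | x i = k} = (n : ENNReal)⁻¹)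
    (s : ℕ) {T : ℕ} (hT : 0 < T) (i : Fin m) (k : Fin n) :
    Integrable (fun p => ∫ z, f (sgpOutput P γ f w0 s T p.1 p.2) z ∂(D i)) (runLaw n D ν) ∧
    ∫ p, ∫ z, f (sgpOutput P γ f w0 s T p.1 p.2) z ∂(D i) ∂(runLaw n D ν) ≤
      ∫ p, f (sgpOutput P γ f w0 s T p.1 p.2) (p.1 i k) ∂(runLaw n D ν) +
        G * ∑ t ∈ Finset.range (s + T), γ t * (2 * L * consensusBound π G W lam C γ t +
          2 * G / m * (n : ℝ)⁻¹) := by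
  set A : (Fin m → Fin n → Z) × (ℕ → Fin m → Fin n) → EuclideanSpace ℝ (Fin d) :=
    fun p => sgpOutput P γ f w0 s T p.1 p.2 with hA
  have hAm : Measurable A := measurable_sgpOutput h.loss h.L_pos s T
  have hAb : ∀ p, ‖A p‖ ≤ W + (s + T : ℕ) * (2 / L * G) := fun p =>
    h.norm_sgpOutput_le s hT p.1 p.2
  set Q := runLaw n D ν with hQ
  have hI1 : Integrable (fun q : _ × Z => f (A q.1) q.2) (Q.prod (D i)) :=
    integrable_loss_comp h.loss h.G_nonneg (fun w => hint w i) (hAm.comp measurable_fst)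
      (fun q => hAb q.1) measurePreserving_snd
  refine ⟨hI1.integral_prod_left, ?_⟩
  set e : (Fin m → Fin n → Z) × (ℕ → Fin m → Fin n) → Z := fun p => p.1 i k with he
  have hem : MeasurePreserving e Q (D i) := measurePreserving_sample i k
  set upd : (Fin m → Fin n → Z) × (ℕ → Fin m → Fin n) → Z →
      (Fin m → Fin n → Z) × (ℕ → Fin m → Fin n) := fun p z =>
      (Function.update p.1 i (Function.update (p.1 i) k z), p.2) with hupd
  have hres : IsResampling Q (D i) upd := isResampling_runLaw i k
  have hswap : MeasurePreserving (fun p : _ × Z => (upd p.1 p.2, e p.1))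
      (Q.prod (D i)) (Q.prod (D i)) :=
    hres.measurePreserving_swap hem.measurable (fun x z => by simp [he, hupd])
      (fun x y z => by simp [hupd])
  have hI2 : Integrable (fun q : _ × Z => f (A (upd q.1 q.2)) (e q.1)) (Q.prod (D i)) :=
    hswap.integrable_comp_of_integrable hI1
  have hI3 : Integrable (fun p => f (A p) (e p)) Q :=
    integrable_loss_comp h.loss h.G_nonneg (fun w => hint w i) hAm hAb hem
  set ind : ℕ → (Fin m → Fin n → Z) × (ℕ → Fin m → Fin n) → ℝ := fun t p =>
    if p.2 t i = k then 1 else 0 with hind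
  have hindm : ∀ t, Measurable (ind t) := fun t => by
    have h1 : Measurable (fun x : Fin n => if x = k then (1 : ℝ) else 0) :=
      measurable_of_countable _
    have h2 : Measurable (fun p : (Fin m → Fin n → Z) × (ℕ → Fin m → Fin n) => p.2 t i) :=
      (measurable_pi_apply i).comp ((measurable_pi_apply t).comp measurable_snd)
    exact h1.comp h2
  have hindi : ∀ t, Integrable (ind t) Q := fun t => by
    refine Integrable.mono' (integrable_const 1) (hindm t).aestronglyMeasurable
      (Filter.Eventually.of_forall fun p => ?_)
    simp only [hind]
    split_ifs <;> simp
  have hindv : ∀ t, ∫ p, ind t p ∂Q = (n : ℝ)⁻¹ := fun t => by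
    have h1 := hindi t
    simp only [hQ, runLaw] at h1 ⊢
    rw [integral_prod _ h1]
    have h2 := integral_indicator_mul_eq (φ := fun _ => (1 : ℝ)) (t := t) hν (fun _ _ _ => rfl) i k
    simp only [mul_one, integral_const, probReal_univ, smul_eq_mul] at h2
    simp only [hind, h2, integral_const, probReal_univ, smul_eq_mul, one_mul]
  set st : (Fin m → Fin n → Z) × (ℕ → Fin m → Fin n) → ℝ := fun p =>
    ∑ t ∈ Finset.range (s + T), γ t * (2 * L * consensusBound π G W lam C γ t +
          2 * G / m * ind t p) with hst
  have hti : ∀ t, Integrable (fun p => γ t * (2 * L * consensusBound π G W lam C γ t +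
      2 * G / m * ind t p)) Q := fun t =>
    ((integrable_const _).add ((hindi t).const_mul _)).const_mul _
  have hsti : Integrable st Q := integrable_finsetSum _ fun t _ => hti t
  have hstv : ∫ p, st p ∂Q = ∑ t ∈ Finset.range (s + T), γ t *
      (2 * L * consensusBound π G W lam C γ t + 2 * G / m * (n : ℝ)⁻¹) := by
    simp only [hst]
    rw [integral_finsetSum _ fun t _ => hti t]
    refine Finset.sum_congr rfl fun t _ => ?_
    rw [integral_const_mul, integral_add (integrable_const _) ((hindi t).const_mul _),
      integral_const_mul (2 * G / m), hindv]
    simp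
  have hI4 : Integrable (fun p => f (A p) (e p) + G * st p) Q := hI3.add (hsti.const_mul G)
  -- The old sample and the fresh one are exchangeable, so the loss of the output on the fresh
  -- sample has the same mean as the loss of the perturbed output on the old sample; stability then
  -- restores the original output.
  calc ∫ p, ∫ z, f (A p) z ∂(D i) ∂Q = ∫ q, f (A q.1) q.2 ∂(Q.prod (D i)) :=
        (integral_prod _ hI1).symm
    _ = ∫ q, f (A (upd q.1 q.2)) (e q.1) ∂(Q.prod (D i)) := by
        conv_lhs => rw [← hswap.map_eq]
        refine integral_map hswap.measurable.aemeasurable ?_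
        rw [hswap.map_eq]
        exact hI1.aestronglyMeasurable
    _ ≤ ∫ q, (f (A q.1) (e q.1) + G * st q.1) ∂(Q.prod (D i)) := by
        refine integral_mono hI2 (hI4.comp_fst (D i)) fun q => ?_
        have h1 := (le_abs_self _).trans (h.loss.lipschitz (e q.1) (A q.1) (A (upd q.1 q.2)))
        have h2 : ‖A (upd q.1 q.2) - A q.1‖ ≤ st q.1 := by
          refine h.norm_sgpOutput_sub_le (i := i) (k := k) s hT q.1.2 fun j l hjl => ?_
          rcases eq_or_ne j i with rfl | hj
          · have hl : l ≠ k := hjl.resolve_left (by simp)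
            simp [hupd, hl]
          · simp [hupd, hj]
        have h3 := mul_le_mul_of_nonneg_left h2 h.G_nonneg
        change f (A (upd q.1 q.2)) (e q.1) ≤ f (A q.1) (e q.1) + G * st q.1
        linarith
    _ = ∫ p, (f (A p) (e p) + G * st p) ∂Q := by
        rw [integral_prod _ (hI4.comp_fst (D i))]
        simp
    _ = _ := by
        rw [integral_add hI3 (hsti.const_mul G), integral_const_mul, hstv]

/-- Expected excess risk of the averaged output of SGP in terms of the step sizes. -/
lemma integrable_and_excess_le (h : IsSGPSetting G L W lam C P π γ f w0) (hn : 0 < n)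
    (hint : ∀ w i, Integrable (f w) (D i)) (hν : ∀ i k, ν {x | x i = k} = (n : ENNReal)⁻¹)
    {v : EuclideanSpace ℝ (Fin d)} {r : ℝ} (hv : ‖v‖ ≤ r) {s : ℕ} (hs : s ≤ 1) {T : ℕ}
    (hT : 0 < T) :
    Integrable (fun p => popRisk f D (sgpOutput P γ f w0 s T p.1 p.2)) (runLaw n D ν) ∧
    ∫ p, (popRisk f D (sgpOutput P γ f w0 s T p.1 p.2) - popRisk f D v) ∂(runLaw n D ν) ≤
      (∑ t ∈ Finset.Ico s (s + T), γ t)⁻¹ * ((W + 2 / L * G + r) ^ 2 / 2 +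
        ∑ t ∈ Finset.range (s + T), (2 * G * (γ t * consensusBound π G W lam C γ t)
          + G ^ 2 / 2 * γ t ^ 2)) +
      G * ∑ t ∈ Finset.range (s + T), γ t * (2 * L * consensusBound π G W lam C γ t +
          2 * G / m * (n : ℝ)⁻¹) := by
  set Q := runLaw n D ν with hQ
  have hmR : (0 : ℝ) < m := by exact_mod_cast h.nodes_pos
  have hnR : (0 : ℝ) < n := by exact_mod_cast hn
  set st := ∑ t ∈ Finset.range (s + T), γ t * (2 * L * consensusBound π G W lam C γ t +
          2 * G / m * (n : ℝ)⁻¹) with hst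
  set Ro := (W + 2 / L * G + r) ^ 2 / 2 +
        ∑ t ∈ Finset.range (s + T), (2 * G * (γ t * consensusBound π G W lam C γ t)
          + G ^ 2 / 2 * γ t ^ 2) with hRo
  set A : (Fin m → Fin n → Z) × (ℕ → Fin m → Fin n) → EuclideanSpace ℝ (Fin d) :=
    fun p => sgpOutput P γ f w0 s T p.1 p.2 with hA
  set M : ℕ → (Fin m → Fin n → Z) × (ℕ → Fin m → Fin n) → EuclideanSpace ℝ (Fin d) :=
    fun t p => sgpMean P γ f w0 p.1 p.2 t with hM
  have hAI : ∀ i k, Integrable (fun p => f (A p) (p.1 i k)) Q := fun i k =>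
    integrable_loss_comp h.loss h.G_nonneg (fun w => hint w i)
      (measurable_sgpOutput h.loss h.L_pos s T) (fun p => h.norm_sgpOutput_le s hT p.1 p.2)
      (measurePreserving_sample i k)
  have hMI : ∀ t i k, Integrable (fun p => f (M t p) (p.1 i k)) Q := fun t i k =>
    integrable_loss_comp h.loss h.G_nonneg (fun w => hint w i)
      (measurable_sgpMean h.loss h.L_pos t) (fun p => h.norm_sgpMean_le p.1 p.2 t)
      (measurePreserving_sample i k)
  have hgen := fun i k => h.integral_loss_fresh_le hint hν s hT i k
  have hFi : ∀ i, Integrable (fun p => ∫ z, f (A p) z ∂(D i)) Q := fun i => (hgen i ⟨0, hn⟩).1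
  have hIA : Integrable (fun p => popRisk f D (A p)) Q :=
    (integrable_finsetSum _ fun i _ => hFi i).const_mul _
  refine ⟨hIA, ?_⟩
  set tot := ∑ t ∈ Finset.Ico s (s + T), γ t with htot
  have htot_pos : 0 < tot := h.sum_step_pos s hT
  -- empirical risk of the consensus model of round `t`
  set FS : ℕ → ℝ := fun t => (m : ℝ)⁻¹ * ∑ i, (n : ℝ)⁻¹ * ∑ k, ∫ p, f (M t p) (p.1 i k) ∂Q with hFS
  -- Generalization: the risk at node `i` does not depend on `k`, so it is written as its own mean
  -- over `k` before the one-sample bounds are averaged.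
  have hstep1 : ∫ p, popRisk f D (A p) ∂Q ≤
      (m : ℝ)⁻¹ * ∑ i, (n : ℝ)⁻¹ * ∑ k, ∫ p, f (A p) (p.1 i k) ∂Q + G * st := by
    simp only [popRisk]
    rw [integral_const_mul, integral_finsetSum _ fun i _ => hFi i, ← mean_const h.nodes_pos
      (G * st), ← mul_add, ← Finset.sum_add_distrib]
    refine mul_le_mul_of_nonneg_left (Finset.sum_le_sum fun i _ => ?_) (by positivity)
    rw [← mean_const hn (∫ p, ∫ z, f (A p) z ∂(D i) ∂Q), ← mean_const hn (G * st), ← mul_add,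
      ← Finset.sum_add_distrib]
    exact mul_le_mul_of_nonneg_left (Finset.sum_le_sum fun k _ => (hgen i k).2) (by positivity)
  have hstep2 : (m : ℝ)⁻¹ * ∑ i, (n : ℝ)⁻¹ * ∑ k, ∫ p, f (A p) (p.1 i k) ∂Q ≤
      tot⁻¹ * ∑ t ∈ Finset.Ico s (s + T), γ t * FS t := by
    have h1 : ∀ i k, ∫ p, f (A p) (p.1 i k) ∂Q ≤
        tot⁻¹ * ∑ t ∈ Finset.Ico s (s + T), γ t * ∫ p, f (M t p) (p.1 i k) ∂Q := by
      intro i k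
      have h2 := integral_mono (hAI i k)
        ((integrable_finsetSum (Finset.Ico s (s + T)) fun t _ =>
          (hMI t i k).const_mul (γ t)).const_mul tot⁻¹)
        fun p => h.loss_sgpOutput_le s hT p.1 p.2 (p.1 i k)
      rw [integral_const_mul, integral_finsetSum _ fun t _ => (hMI t i k).const_mul (γ t)] at h2
      simpa only [integral_const_mul] using h2
    calc _ ≤ (m : ℝ)⁻¹ * ∑ i, (n : ℝ)⁻¹ * ∑ k,
          tot⁻¹ * ∑ t ∈ Finset.Ico s (s + T), γ t * ∫ p, f (M t p) (p.1 i k) ∂Q := by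
          gcongr with i _ k _
          exact h1 i k
      _ = _ := by
          have hc : ∀ i, ∑ k, tot⁻¹ * ∑ t ∈ Finset.Ico s (s + T), γ t * ∫ p, f (M t p) (p.1 i k) ∂Q =
              tot⁻¹ * ∑ t ∈ Finset.Ico s (s + T), γ t * ∑ k, ∫ p, f (M t p) (p.1 i k) ∂Q := by
            intro i
            rw [← Finset.mul_sum, Finset.sum_comm]
            simp only [Finset.mul_sum]
          simp only [hc, hFS]
          simp only [Finset.mul_sum]
          rw [Finset.sum_comm]
          refine Finset.sum_congr rfl fun t _ => Finset.sum_congr rfl fun i _ =>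
            Finset.sum_congr rfl fun k _ => ?_
          ring
  -- Expectation of the pathwise regret: the sampled loss becomes the empirical risk, and at the
  -- deterministic point `v` even the population risk.
  have hstep3 : ∑ t ∈ Finset.Ico s (s + T), γ t * (FS t - popRisk f D v) ≤ Ro := by
    have hx := fun t j => integrable_and_integral_loss_index (ν := ν) h.loss h.G_nonneg hint hν
      (X := M t) (measurable_sgpMean h.loss h.L_pos t) (fun p => h.norm_sgpMean_le p.1 p.2 t)
      (t := t) (fun S ω ω' hω => sgpMean_congr S hω) j
    have hy := fun t j => integrable_and_integral_loss_index (ν := ν) h.loss h.G_nonneg hint hν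
      (X := fun _ => v) measurable_const (fun _ => hv) (t := t) (fun _ _ _ _ => rfl) j
    have hyv : ∀ t j, ∫ p, f v (p.1 j (p.2 t j)) ∂Q = ∫ z, f v z ∂(D j) := by
      intro t j
      rw [(hy t j).2]
      have hk : ∀ k : Fin n, ∫ p, f v (p.1 j k) ∂(runLaw n D ν) = ∫ z, f v z ∂(D j) := by
        intro k
        have hp := measurePreserving_sample (D := D) (ν := ν) j k
        rw [← hp.map_eq, integral_map hp.measurable.aemeasurable]
        rw [hp.map_eq]
        exact (hint v j).aestronglyMeasurable
      simp only [hk]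
      exact mean_const hn _
    have hxy : ∀ t j, Integrable (fun p => f (M t p) (p.1 j (p.2 t j)) - f v (p.1 j (p.2 t j))) Q :=
      fun t j => (hx t j).1.sub (hy t j).1
    have hdi : ∀ t, Integrable (fun p => (m : ℝ)⁻¹ * ∑ j,
        (f (M t p) (p.1 j (p.2 t j)) - f v (p.1 j (p.2 t j)))) Q := fun t =>
      (integrable_finsetSum _ fun j _ => hxy t j).const_mul _
    have hdv : ∀ t, ∫ p, (m : ℝ)⁻¹ * ∑ j,
        (f (M t p) (p.1 j (p.2 t j)) - f v (p.1 j (p.2 t j))) ∂Q = FS t - popRisk f D v := by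
      intro t
      rw [integral_const_mul, integral_finsetSum _ fun j _ => hxy t j]
      simp only [hFS, popRisk]
      rw [← mul_sub, ← Finset.sum_sub_distrib]
      congr 1
      refine Finset.sum_congr rfl fun j _ => ?_
      rw [integral_sub (hx t j).1 (hy t j).1, (hx t j).2, hyv]
    have h1 := integral_mono (integrable_finsetSum (Finset.Ico s (s + T)) fun t _ =>
        (hdi t).const_mul (γ t)) (integrable_const Ro)
        fun p => h.sum_regret_le p.1 p.2 hv hs T
    rw [integral_finsetSum _ fun t _ => (hdi t).const_mul (γ t)] at h1
    simpa only [integral_const_mul, hdv, integral_const, probReal_univ, smul_eq_mul, one_mul]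
      using h1
  rw [integral_sub hIA (integrable_const _)]
  simp only [integral_const, probReal_univ, smul_eq_mul, one_mul]
  have h4 : tot⁻¹ * ∑ t ∈ Finset.Ico s (s + T), γ t * FS t - popRisk f D v ≤ tot⁻¹ * Ro := by
    have h5 := mul_le_mul_of_nonneg_left hstep3 (inv_nonneg.mpr htot_pos.le)
    simp only [mul_sub, Finset.sum_sub_distrib, ← Finset.sum_mul] at h5
    rw [← htot, inv_mul_cancel_left₀ htot_pos.ne'] at h5
    exact h5
  linarith

end IsSGPSetting

end Expectation

/-! ### Excess risk in terms of the sums of the step sizes -/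

section StepSums

/-- The convolution satisfies `x (t + 1) = lam * (x t + a t)`; summing this recursion gives an exact
identity from which the bound is read off. -/
lemma sum_geometric_convolution_le {lam : ℝ} (hl : 0 ≤ lam) (hl1 : lam < 1) {a : ℕ → ℝ}
    (ha : ∀ t, 0 ≤ a t) (N : ℕ) :
    ∑ t ∈ Finset.range N, ∑ s ∈ Finset.range t, a s * lam ^ (t - s) ≤
      (∑ t ∈ Finset.range N, a t) / (1 - lam) := by
  set x : ℕ → ℝ := fun t => ∑ s ∈ Finset.range t, a s * lam ^ (t - s) with hx
  have hxs : ∀ t, x (t + 1) = lam * (x t + a t) := by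
    intro t
    simp only [hx]
    rw [Finset.sum_range_succ, Nat.add_sub_cancel_left, pow_one, mul_add, Finset.mul_sum,
      mul_comm (a t)]
    congr 1
    refine Finset.sum_congr rfl fun s hs => ?_
    rw [Nat.succ_sub (Finset.mem_range.mp hs).le, pow_succ]
    ring
  have hxnn : 0 ≤ x N := Finset.sum_nonneg fun s _ => mul_nonneg (ha s) (pow_nonneg hl _)
  have key : ∀ N, (1 - lam) * ∑ t ∈ Finset.range N, x t + x N =
      lam * ∑ t ∈ Finset.range N, a t := by
    intro N
    induction N with
    | zero => simp [hx]
    | succ N ih =>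
      rw [Finset.sum_range_succ, Finset.sum_range_succ, hxs]
      linarith
  have hann : 0 ≤ ∑ t ∈ Finset.range N, a t := Finset.sum_nonneg fun t _ => ha t
  rw [le_div_iff₀ (by linarith)]
  nlinarith [key N]

lemma sum_pow_le_inv {lam : ℝ} (hl : 0 ≤ lam) (hl1 : lam < 1) (N : ℕ) :
    ∑ t ∈ Finset.range N, lam ^ t ≤ 1 / (1 - lam) := by
  rw [le_div_iff₀ (by linarith)]
  have := geom_sum_mul_neg lam N
  have := pow_nonneg hl N
  linarith

variable {m : ℕ} {P : Matrix (Fin m) (Fin m) ℝ} {π : Fin m → ℝ} {lam C : ℝ}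

lemma topoFactor_pos (hm : 0 < m) (hπ : IsPerronVector P π) (hl1 : lam < 1) :
    0 < topoFactor π lam :=
  mul_pos (hπ.iInf_pos hm) (by linarith)

/-- Monotone step sizes give `γ t * γ s ≤ γ s ^ 2` for `s < t`, so the double sum is a geometric
convolution of the squares; the initial error contributes `γ 0 / (1 - lam)`. -/
lemma sum_step_mul_consensusBound_le (hm : 0 < m) (hπ : IsPerronVector P π) (hl : 0 ≤ lam)
    (hl1 : lam < 1) (hC : IsMixingConstant P π lam C) {G W : ℝ} (hG : 0 ≤ G) (hW : 0 ≤ W)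
    {γ : ℕ → ℝ} (hγ : ∀ t, 0 ≤ γ t) (hanti : Antitone γ) (N : ℕ) :
    ∑ t ∈ Finset.range N, γ t * consensusBound π G W lam C γ t ≤
      2 * C * (C + 1) * (W + G) *
        ((γ 0 + ∑ t ∈ Finset.range N, γ t ^ 2) / topoFactor π lam) := by
  have hC0 := hC.nonneg hm
  have hδ := hπ.iInf_pos hm
  have h1l : 0 < 1 - lam := by linarith
  have h1 : ∑ t ∈ Finset.range N, γ t * lam ^ t ≤ γ 0 / (1 - lam) := by
    calc ∑ t ∈ Finset.range N, γ t * lam ^ t ≤ ∑ t ∈ Finset.range N, γ 0 * lam ^ t :=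
          Finset.sum_le_sum fun t _ =>
            mul_le_mul_of_nonneg_right (hanti (Nat.zero_le t)) (pow_nonneg hl t)
      _ ≤ γ 0 * (1 / (1 - lam)) := by
          rw [← Finset.mul_sum]
          exact mul_le_mul_of_nonneg_left (sum_pow_le_inv hl hl1 N) (hγ 0)
      _ = _ := by ring
  have h2 : ∑ t ∈ Finset.range N, γ t * ∑ s ∈ Finset.range t, γ s * lam ^ (t - s) ≤
      (∑ t ∈ Finset.range N, γ t ^ 2) / (1 - lam) := by
    refine le_trans (Finset.sum_le_sum fun t _ => ?_)
      (sum_geometric_convolution_le hl hl1 (fun t => sq_nonneg (γ t)) N)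
    rw [Finset.mul_sum]
    refine Finset.sum_le_sum fun s hs => ?_
    rw [← mul_assoc, sq]
    exact mul_le_mul_of_nonneg_right
      (mul_le_mul_of_nonneg_right (hanti (Finset.mem_range.mp hs).le) (hγ s)) (pow_nonneg hl _)
  have hS2 : 0 ≤ ∑ t ∈ Finset.range N, γ t ^ 2 := Finset.sum_nonneg fun t _ => sq_nonneg _
  have e : ∑ t ∈ Finset.range N, γ t * consensusBound π G W lam C γ t =
      2 * C * (C + 1) / (⨅ i, π i) * (W * ∑ t ∈ Finset.range N, γ t * lam ^ t +
        G * ∑ t ∈ Finset.range N, γ t * ∑ s ∈ Finset.range t, γ s * lam ^ (t - s)) := by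
    rw [Finset.mul_sum, Finset.mul_sum, ← Finset.sum_add_distrib, Finset.mul_sum]
    refine Finset.sum_congr rfl fun t _ => ?_
    rw [consensusBound]
    ring
  rw [e]
  calc _ ≤ 2 * C * (C + 1) / (⨅ i, π i) * (W * (γ 0 / (1 - lam)) +
          G * ((∑ t ∈ Finset.range N, γ t ^ 2) / (1 - lam))) := by gcongr
    _ ≤ 2 * C * (C + 1) / (⨅ i, π i) * ((W + G) *
          ((γ 0 + ∑ t ∈ Finset.range N, γ t ^ 2) / (1 - lam))) := by
        refine mul_le_mul_of_nonneg_left ?_ (by positivity)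
        have ha : 0 ≤ γ 0 / (1 - lam) := div_nonneg (hγ 0) h1l.le
        have hb : 0 ≤ (∑ t ∈ Finset.range N, γ t ^ 2) / (1 - lam) := div_nonneg hS2 h1l.le
        rw [add_div]
        nlinarith
    _ = _ := by
        rw [topoFactor]
        field_simp

/-- The constant in front of the excess risk bound. -/
def excessConst (G L r W C : ℝ) : ℝ :=
  (|W| + 2 / L * G + r) ^ 2 / 2 + G ^ 2 / 2 + (2 * G + 2 * G * L) * (2 * C * (C + 1) * (|W| + G))
    + 2 * G ^ 2

/-- With `|W|` in the constant this needs no sign of `W`; `0 ≤ W` only follows once a run exists. -/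
lemma excessConst_nonneg {G L r W C : ℝ} (hG : 0 ≤ G) (hL : 0 < L) (hC : 0 ≤ C) :
    0 ≤ excessConst G L r W C := by
  unfold excessConst; positivity

/-- Reduces both step-size regimes to a scalar inequality between the sums of `γ t` and of `γ t ^
2`; one constant dominates every coefficient of the regret and stability bounds. -/
lemma excessRiskAtMost_of_le {n : ℕ} {G L r W B : ℝ} {γ : ℕ → ℝ} {T : ℕ} (hm : 0 < m)
    (hn : 0 < n) (hG : 0 ≤ G) (hL : 0 < L) (hP : ∀ i j, 0 ≤ P i j) (hs : ∀ j, ∑ i, P i j = 1)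
    (hπ : IsPerronVector P π) (hl : 0 ≤ lam) (hl1 : lam < 1) (hC : IsMixingConstant P π lam C)
    (hγ : ∀ t, 0 < γ t) (hγL : γ 0 ≤ 2 / L) (hanti : Antitone γ) (hT : 0 < T)
    (hB : ∀ s ≤ 1, excessConst G L r W C *
      ((∑ t ∈ Finset.Ico s (s + T), γ t)⁻¹ * (1 + ∑ t ∈ Finset.range (s + T), γ t ^ 2 +
          (γ 0 + ∑ t ∈ Finset.range (s + T), γ t ^ 2) / topoFactor π lam) +
        (γ 0 + ∑ t ∈ Finset.range (s + T), γ t ^ 2) / topoFactor π lam +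
        (∑ t ∈ Finset.range (s + T), γ t) / (m * n)) ≤ B) :
    ExcessRiskAtMost.{u} n G L r W P γ T B := by
  rintro d Z _ f D _ ν _ w0 wstar ⟨hloss, hint, hunif, hW0, -, hstar, -⟩ s hs1
  have hset : IsSGPSetting G L W lam C P π γ f w0 :=
    ⟨hm, hG, hL, hP, hs, hπ, hl, hl1, hC, hloss, hγ,
      fun t => (hanti (Nat.zero_le t)).trans hγL, hW0⟩
  have hW := hset.W_nonneg
  obtain ⟨h1, h2⟩ := hset.integrable_and_excess_le hn hint hunif hstar
    hs1 hT
  refine ⟨h1, h2.trans (le_trans ?_ (hB s hs1))⟩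
  have hC0 := hC.nonneg hm
  have htot := hset.sum_step_pos s hT
  have hκ := topoFactor_pos (lam := lam) hm hπ hl1
  have hmR : (0 : ℝ) < m := by exact_mod_cast hm
  have hnR : (0 : ℝ) < n := by exact_mod_cast hn
  have hY := sum_step_mul_consensusBound_le hm hπ hl hl1 hC hG hW (fun t => (hγ t).le) hanti (s + T)
  set Y := ∑ t ∈ Finset.range (s + T), γ t * consensusBound π G W lam C γ t with hYdef
  set S2 := ∑ t ∈ Finset.range (s + T), γ t ^ 2 with hS2
  set S1 := ∑ t ∈ Finset.range (s + T), γ t with hS1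
  set q := (γ 0 + S2) / topoFactor π lam with hq
  set K := excessConst G L r W C with hK
  have hS2nn : 0 ≤ S2 := Finset.sum_nonneg fun t _ => sq_nonneg _
  have hS1nn : 0 ≤ S1 := Finset.sum_nonneg fun t _ => (hγ t).le
  have hqnn : 0 ≤ q := div_nonneg (add_nonneg (hγ 0).le hS2nn) hκ.le
  have hr2 : 0 ≤ (W + 2 / L * G + r) ^ 2 / 2 := by positivity
  set B' := 2 * C * (C + 1) * (W + G) with hB'
  have hB'nn : 0 ≤ B' := by positivity
  have hKe : K = (W + 2 / L * G + r) ^ 2 / 2 + G ^ 2 / 2 + (2 * G + 2 * G * L) * B' +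
      2 * G ^ 2 := by
    rw [hK, excessConst, abs_of_nonneg hW]
  have hGL : 0 ≤ G * L := mul_nonneg hG hL.le
  have p1 := sq_nonneg G
  have p2 := mul_nonneg hG hB'nn
  have p3 := mul_nonneg hGL hB'nn
  have hk1 : (W + 2 / L * G + r) ^ 2 / 2 ≤ K := by rw [hKe]; linarith
  have hk2 : G ^ 2 / 2 ≤ K := by rw [hKe]; linarith
  have hk3 : 2 * G * B' ≤ K := by rw [hKe]; linarith
  have hk4 : 2 * G * L * B' ≤ K := by rw [hKe]; linarith
  have hk5 : 2 * G ^ 2 ≤ K := by rw [hKe]; linarith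
  have e1 : ∑ t ∈ Finset.range (s + T), (2 * G * (γ t * consensusBound π G W lam C γ t)
      + G ^ 2 / 2 * γ t ^ 2) = 2 * G * Y + G ^ 2 / 2 * S2 := by
    rw [Finset.sum_add_distrib, ← Finset.mul_sum, ← Finset.mul_sum]
  have e2 : G * ∑ t ∈ Finset.range (s + T), γ t * (2 * L * consensusBound π G W lam C γ t +
      2 * G / m * (n : ℝ)⁻¹) = 2 * G * L * Y + 2 * G ^ 2 * (S1 / (m * n)) := by
    have : ∀ t, γ t * (2 * L * consensusBound π G W lam C γ t + 2 * G / m * (n : ℝ)⁻¹) =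
        2 * L * (γ t * consensusBound π G W lam C γ t) + 2 * G / m * (n : ℝ)⁻¹ * γ t := by
      intro t; ring
    simp only [this]
    rw [Finset.sum_add_distrib, ← Finset.mul_sum, ← Finset.mul_sum, ← hYdef, ← hS1]
    field_simp
  rw [e1, e2]
  have i1 : 2 * G * Y ≤ K * q := by
    calc 2 * G * Y ≤ 2 * G * (B' * q) := mul_le_mul_of_nonneg_left hY (by positivity)
      _ = (2 * G * B') * q := by ring
      _ ≤ _ := mul_le_mul_of_nonneg_right hk3 hqnn
  have i2 : 2 * G * L * Y ≤ K * q := by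
    calc 2 * G * L * Y ≤ 2 * G * L * (B' * q) := mul_le_mul_of_nonneg_left hY (by positivity)
      _ = (2 * G * L * B') * q := by ring
      _ ≤ _ := mul_le_mul_of_nonneg_right hk4 hqnn
  have i3 : G ^ 2 / 2 * S2 ≤ K * S2 := mul_le_mul_of_nonneg_right hk2 hS2nn
  have i4 : 2 * G ^ 2 * (S1 / (m * n)) ≤ K * (S1 / (m * n)) :=
    mul_le_mul_of_nonneg_right hk5 (by positivity)
  have i5 : (∑ t ∈ Finset.Ico s (s + T), γ t)⁻¹ *
      ((W + 2 / L * G + r) ^ 2 / 2 + (2 * G * Y + G ^ 2 / 2 * S2)) ≤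
      (∑ t ∈ Finset.Ico s (s + T), γ t)⁻¹ * (K * (1 + S2 + q)) :=
    mul_le_mul_of_nonneg_left (by linarith) (inv_nonneg.mpr htot.le)
  calc _ ≤ (∑ t ∈ Finset.Ico s (s + T), γ t)⁻¹ * (K * (1 + S2 + q)) +
        (K * q + K * (S1 / (m * n))) := add_le_add i5 (add_le_add i2 i4)
    _ = _ := by ring

end StepSums

/-! ### Early stopping with constant step sizes -/

section ConstantStep

lemma real_sqrt_add_le {x y : ℝ} (hx : 0 ≤ x) (hy : 0 ≤ y) : √(x + y) ≤ √x + √y := by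
  refine Real.sqrt_le_iff.mpr ⟨by positivity, ?_⟩
  nlinarith [Real.sq_sqrt hx, Real.sq_sqrt hy, mul_nonneg (Real.sqrt_nonneg x) (Real.sqrt_nonneg y)]

variable {N κ γ : ℝ}

/-- `a² = (1 + γ/κ) / (1/N + γ/κ)` is the balanced value of `(T γ)²`. The bounds come from `1/a² ≤
1/N + γ/κ`, `a² ≤ N` and `a² (γ/κ) ≤ 1 + γ/κ`. -/
lemma constStep_bounds (hN : 1 ≤ N) (hκ : 0 < κ) (hγ : 0 < γ) :
    let a := √N * √((κ + γ) / (κ + N * γ))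
    1 ≤ a ∧ 1 / a ≤ 1 / √N + √(γ / κ) ∧ a / N ≤ 1 / √N ∧ a * (γ / κ) ≤ √(γ / κ) + γ / κ := by
  intro a
  have hN0 : 0 < N := by linarith
  have hd : 0 < κ + N * γ := by positivity
  have ha : a = √(N * ((κ + γ) / (κ + N * γ))) := (Real.sqrt_mul hN0.le _).symm
  have hapos : 0 < a := by rw [ha]; positivity
  have hNγ : γ ≤ N * γ := by nlinarith
  have hNκ : κ ≤ N * κ := by nlinarith
  refine ⟨?_, ?_, ?_, ?_⟩
  · rw [ha, Real.one_le_sqrt, ← mul_div_assoc, one_le_div hd]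
    nlinarith
  · have h1 : 1 / a ≤ √(1 / N + γ / κ) := by
      rw [ha, one_div, ← Real.sqrt_inv]
      refine Real.sqrt_le_sqrt ?_
      rw [← mul_div_assoc, inv_div, div_add_div _ _ hN0.ne' hκ.ne',
        div_le_div_iff₀ (by positivity) (by positivity)]
      have : 0 ≤ N * γ * (κ + N * γ) := by positivity
      nlinarith
    refine h1.trans ((real_sqrt_add_le (by positivity) (by positivity)).trans (le_of_eq ?_))
    rw [Real.sqrt_div zero_le_one, Real.sqrt_one]
  · have h1 : a ≤ √N := by
      refine mul_le_of_le_one_right (Real.sqrt_nonneg _) ?_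
      rw [Real.sqrt_le_one, div_le_one hd]
      linarith
    rw [div_le_div_iff₀ hN0 (by positivity)]
    nlinarith [Real.mul_self_sqrt hN0.le, Real.sqrt_nonneg N]
  · have h1 : a * (γ / κ) ≤ √(γ / κ + (γ / κ) ^ 2) := by
      refine Real.le_sqrt_of_sq_le ?_
      rw [mul_pow, ha, Real.sq_sqrt (by positivity)]
      have h2 : N * ((κ + γ) / (κ + N * γ)) ≤ (κ + γ) / γ := by
        rw [← mul_div_assoc, div_le_div_iff₀ hd hγ]
        nlinarith [mul_pos hκ (add_pos hκ hγ)]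
      refine (mul_le_mul_of_nonneg_right h2 (sq_nonneg _)).trans (le_of_eq ?_)
      field_simp
    refine h1.trans ((real_sqrt_add_le (by positivity) (by positivity)).trans (le_of_eq ?_))
    rw [Real.sqrt_sq (by positivity)]

end ConstantStep

/-! ### Early stopping with diminishing step sizes -/

section DiminishingStep

/-- The logarithm telescopes, each increment being at most `1 / (t + 1)` by `log x ≤ x - 1`. -/
lemma log_le_sum_inv (s T : ℕ) :
    Real.log (((s : ℝ) + T + 1) / (s + 1)) ≤ ∑ t ∈ Finset.Ico s (s + T), 1 / ((t : ℝ) + 1) := by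
  induction T with
  | zero =>
    have : ((s : ℝ) + 1) ≠ 0 := by positivity
    simp [this]
  | succ T ih =>
    rw [← add_assoc, Finset.sum_Ico_succ_top (by omega)]
    have h0 : (0 : ℝ) < (s : ℝ) + T + 1 := by positivity
    have h1 := Real.log_le_sub_one_of_pos (x := ((s : ℝ) + T + 2) / (s + T + 1)) (by positivity)
    have h2 : Real.log (((s : ℝ) + (T + 1 : ℕ) + 1) / (s + 1)) =
        Real.log (((s : ℝ) + T + 1) / (s + 1)) + Real.log (((s : ℝ) + T + 2) / (s + T + 1)) := by
      rw [← Real.log_mul (by positivity) (by positivity)]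
      congr 1
      push_cast
      field_simp
      ring
    have h3 : ((s : ℝ) + T + 2) / (s + T + 1) - 1 = 1 / (((s + T : ℕ) : ℝ) + 1) := by
      push_cast
      field_simp
      ring
    rw [h2]
    linarith

lemma sum_inv_sq_le_two (N : ℕ) : ∑ t ∈ Finset.range N, (1 / ((t : ℝ) + 1)) ^ 2 ≤ 2 := by
  have key : ∀ N : ℕ,
      ∑ t ∈ Finset.range (N + 1), (1 / ((t : ℝ) + 1)) ^ 2 ≤ 2 - 1 / ((N : ℝ) + 1) := by
    intro N
    induction N with
    | zero => norm_num
    | succ N ih =>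
      rw [Finset.sum_range_succ]
      have : (1 / (((N + 1 : ℕ) : ℝ) + 1)) ^ 2 ≤
          1 / ((N : ℝ) + 1) - 1 / (((N + 1 : ℕ) : ℝ) + 1) := by
        push_cast
        rw [div_sub_div _ _ (by positivity) (by positivity), div_pow,
          div_le_div_iff₀ (by positivity) (by positivity)]
        have : (0 : ℝ) ≤ N := Nat.cast_nonneg N
        nlinarith
      linarith
  rcases N with _ | N
  · simp
  · exact (key N).trans (sub_le_self _ (by positivity))

lemma sum_inv_le_one_add_log (N : ℕ) :
    ∑ t ∈ Finset.range N, 1 / ((t : ℝ) + 1) ≤ 1 + Real.log N := by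
  have := harmonic_le_one_add_log N
  simpa [harmonic] using this

/-- With `x = exp (A / 2)` the claim is `x (s + 1) ≤ s + T + 1`, where `T ≥ x²`: immediate for `x ≤
1`, and otherwise from `2 x ≤ x² + 1`. Halving `A` pays for the denominator `s + 1`. -/
lemma half_le_log_of_exp_le {A T s : ℝ} (hT : Real.exp A ≤ T) (hs0 : 0 ≤ s) (hs : s ≤ 1) :
    A / 2 ≤ Real.log ((s + T + 1) / (s + 1)) := by
  have h0 := Real.exp_pos A
  rw [Real.le_log_iff_exp_le (div_pos (by linarith) (by linarith)), le_div_iff₀ (by linarith)]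
  have h1 : Real.exp A = Real.exp (A / 2) ^ 2 := by
    rw [← Real.exp_nat_mul]; congr 1; push_cast; ring
  have h2 := Real.exp_pos (A / 2)
  rcases le_or_gt (Real.exp (A / 2)) 1 with h | h
  · nlinarith
  · nlinarith [sq_nonneg (Real.exp (A / 2) - 1)]

end DiminishingStep

/-! ### Balancing the bound and choosing the stopping times. -/

section EarlyStopping

/-- `y` stands for `T γ`, equal to the balanced value `a` up to the rounding factor `1 + 2 ℓ`, and
`M` for the number `s + T` of rounds run, with `ℓ = 1 / L`. -/
lemma constStep_sum_le {N κ γ ℓ a y M : ℝ} (hN0 : 0 < N) (hκ : 0 < κ) (hγ : 0 < γ)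
    (hLinv : 0 < ℓ) (ha1 : 1 ≤ a) (ha2 : 1 / a ≤ 1 / √N + √(γ / κ)) (ha3 : a / N ≤ 1 / √N)
    (ha4 : a * (γ / κ) ≤ √(γ / κ) + γ / κ) (hya : a ≤ y) (hyc : y ≤ (1 + 2 * ℓ) * a)
    (hMγ : M * γ ≤ 2 * y) :
    y⁻¹ * (1 + M * γ ^ 2 + (γ + M * γ ^ 2) / κ) + (γ + M * γ ^ 2) / κ + M * γ / N ≤
      (8 + 12 * ℓ) * (1 / √N + √(γ / κ) + γ / κ + γ) := by
  have hMγ2 : M * γ ^ 2 ≤ 2 * y * γ := by nlinarith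
  have hy1 : 1 ≤ y := ha1.trans hya
  have hy0 : 0 < y := by linarith
  set p := 1 / √N with hp
  set q := √(γ / κ) with hq
  set x := γ / κ with hx
  have hp0 : 0 ≤ p := by positivity
  have hq0 : 0 ≤ q := Real.sqrt_nonneg _
  have hx0 : 0 < x := div_pos hγ hκ
  have hinv : y⁻¹ ≤ p + q := by
    refine le_trans ?_ ha2
    rw [one_div]
    exact inv_anti₀ (by linarith) hya
  have hinv1 : y⁻¹ ≤ 1 := inv_le_one_of_one_le₀ hy1
  have hyx : y * x ≤ (1 + 2 * ℓ) * (q + x) := by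
    calc y * x ≤ (1 + 2 * ℓ) * a * x := mul_le_mul_of_nonneg_right hyc hx0.le
      _ = (1 + 2 * ℓ) * (a * x) := by ring
      _ ≤ _ := mul_le_mul_of_nonneg_left ha4 (by positivity)
  have hyN : y / N ≤ (1 + 2 * ℓ) * p := by
    calc y / N ≤ (1 + 2 * ℓ) * a / N := div_le_div_of_nonneg_right hyc hN0.le
      _ = (1 + 2 * ℓ) * (a / N) := by ring
      _ ≤ _ := mul_le_mul_of_nonneg_left ha3 (by positivity)
  have b1 : y⁻¹ * (1 + M * γ ^ 2 + (γ + M * γ ^ 2) / κ) ≤ (p + q) + 2 * γ + (x + 2 * x) := by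
    calc y⁻¹ * (1 + M * γ ^ 2 + (γ + M * γ ^ 2) / κ) ≤
          y⁻¹ * (1 + 2 * y * γ + (γ + 2 * y * γ) / κ) := by gcongr
      _ = y⁻¹ + 2 * γ + (y⁻¹ * x + 2 * x) := by rw [hx]; field_simp
      _ ≤ _ := by nlinarith
  have b2 : (γ + M * γ ^ 2) / κ ≤ x + 2 * ((1 + 2 * ℓ) * (q + x)) := by
    calc (γ + M * γ ^ 2) / κ ≤ (γ + 2 * y * γ) / κ := by gcongr
      _ = x + 2 * (y * x) := by rw [hx]; ring
      _ ≤ _ := by linarith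
  have b3 : M * γ / N ≤ 2 * ((1 + 2 * ℓ) * p) := by
    calc M * γ / N ≤ 2 * y / N := by gcongr
      _ = 2 * (y / N) := by ring
      _ ≤ _ := by linarith
  have := mul_nonneg hLinv.le hp0
  have := mul_nonneg hLinv.le hq0
  have := mul_nonneg hLinv.le hx0.le
  have := mul_nonneg hLinv.le hγ.le
  linarith

/-- `A` is the logarithm of the unrounded stopping time and `ℓ = 1 / L`. The reciprocal of `tot` is
at most `2 / √N`, the sum term gives `v A / N ≤ 1/√N + v/√(N κ)`, and `v ≤ 2 ℓ` reduces `v²/κ` to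
`v/κ`. -/
lemma diminishingStep_sum_le {N κ v ℓ A tot S1 S2 : ℝ} (hN1 : 1 ≤ N) (hκ : 0 < κ) (hv : 0 < v)
    (hLinv : 0 < ℓ) (hvL : v ≤ 2 * ℓ) (hApos : 0 < A) (hA1 : 1 ≤ 2 * ℓ * A)
    (hvA : v * A = √N * √(1 + v ^ 2 / κ)) (htot : v * A / 2 ≤ tot) (hS2nn : 0 ≤ S2)
    (es2 : S2 ≤ 2 * v ^ 2) (hlog : S1 ≤ v * (4 + A)) :
    tot⁻¹ * (1 + S2 + (v + S2) / κ) + (v + S2) / κ + S1 / N ≤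
      (8 + 12 * ℓ) * (1 / √N + v / κ + v / √(N * κ) + v ^ 2) := by
  have hN0 : 0 < N := by linarith
  set R := √N with hR
  have hR1 : 1 ≤ R := Real.one_le_sqrt.mpr hN1
  have hRR : R * R = N := Real.mul_self_sqrt hN0.le
  set S := √(1 + v ^ 2 / κ) with hS
  have hS1 : 1 ≤ S := Real.one_le_sqrt.mpr (le_add_of_nonneg_right (by positivity))
  set p := 1 / R with hp
  have hp0 : 0 < p := by positivity
  have hp1 : p ≤ 1 := by rw [hp, div_le_one (by linarith)]; exact hR1
  have hpp : 1 / N = p * p := by rw [hp, ← hRR]; field_simp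
  set x := v / κ with hx
  have hx0 : 0 < x := div_pos hv hκ
  set y := v / √(N * κ) with hy
  have hy0 : 0 < y := by positivity
  have hSy : p * S ≤ p + y := by
    have h1 : S ≤ 1 + v / √κ := by
      refine (real_sqrt_add_le zero_le_one (by positivity)).trans (le_of_eq ?_)
      rw [Real.sqrt_one, Real.sqrt_div (sq_nonneg v), Real.sqrt_sq hv.le]
    have h2 : y = p * (v / √κ) := by
      rw [hy, hp, Real.sqrt_mul hN0.le, ← hR]
      field_simp
    rw [h2]
    nlinarith
  -- the reciprocal of `v A`
  have hw : 1 / (v * A) ≤ p := by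
    rw [hvA, hp]
    exact one_div_le_one_div_of_le (by linarith) (by nlinarith)
  set w := 1 / (v * A) with hwdef
  have hw0 : 0 < w := by positivity
  have hx2 : v * x ≤ 2 * ℓ * x := mul_le_mul_of_nonneg_right hvL hx0.le
  have hwv : w * v ≤ 2 * ℓ := by
    have : w * v = 1 / A := by rw [hwdef]; field_simp
    rw [this, div_le_iff₀ hApos]
    exact hA1
  have hwx : w * v ^ 2 ≤ v ^ 2 := by
    have : w ≤ 1 := hw.trans hp1
    nlinarith [sq_nonneg v]
  have hwq : w * x ≤ x := by
    have : w ≤ 1 := hw.trans hp1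
    nlinarith
  have b1 : tot⁻¹ *
      (1 + S2 + (v + S2) / κ) ≤ 2 * p + 4 * v ^ 2 + (2 * x + 8 * ℓ * x) := by
    have h1 : tot⁻¹ ≤ 2 * w := by
      refine (inv_anti₀ (by positivity) htot).trans (le_of_eq ?_)
      rw [hwdef]; field_simp
    calc _ ≤ 2 * w * (1 + 2 * v ^ 2 + (v + 2 * v ^ 2) / κ) := by gcongr
      _ = 2 * w + 4 * (w * v ^ 2) + (2 * (w * x) + 4 * ((w * v) * x)) := by rw [hx]; ring
      _ ≤ 2 * p + 4 * v ^ 2 + (2 * x + 4 * ((2 * ℓ) * x)) := by gcongr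
      _ = _ := by ring
  have b2 : (v + S2) / κ ≤ x + 4 * ℓ * x := by
    calc (v + S2) / κ ≤ (v + 2 * v ^ 2) / κ := by gcongr
      _ = x + 2 * (v * x) := by rw [hx]; ring
      _ ≤ _ := by linarith
  have b3 : S1 / N ≤ 8 * ℓ * p + (p + y) := by
    calc _ ≤ v * (4 + A) / N := div_le_div_of_nonneg_right hlog hN0.le
      _ = 4 * v * (1 / N) + v * A * (1 / N) := by ring
      _ = 4 * v * p * p + p * S := by
          rw [hvA, hpp]
          have : R * p = 1 := by rw [hp]; field_simp
          linear_combination p * S * this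
      _ ≤ 4 * (2 * ℓ) * p * 1 + (p + y) := by
          gcongr
      _ = _ := by ring
  have := mul_pos hLinv hp0
  have := mul_pos hLinv hx0
  have := mul_pos hLinv hy0
  have := mul_pos hLinv (pow_pos hv 2)
  have := pow_pos hv 2
  linarith


variable {m n : ℕ} {P : Matrix (Fin m) (Fin m) ℝ} {π : Fin m → ℝ} {G L r W lam C K : ℝ}

lemma sum_Ico_const (s T : ℕ) (γ : ℝ) : ∑ _t ∈ Finset.Ico s (s + T), γ = T * γ := by
  simp

lemma exists_stopping_time_const (hm : 0 < m) (hn : 0 < n) (hG : 0 ≤ G) (hL : 0 < L)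
    (hP : ∀ i j, 0 ≤ P i j) (hs : ∀ j, ∑ i, P i j = 1)
    (hπ : IsPerronVector P π) (hl : 0 ≤ lam) (hl1 : lam < 1) (hC : IsMixingConstant P π lam C)
    (hK : K = excessConst G L r W C * (8 + 12 / L) + (2 + 4 / L))
    {γ : ℝ} (hγ : 0 < γ) (hγL : γ ≤ 2 / L) :
    ∃ T : ℕ, 0 < T ∧
      √(m * n) / γ * √((topoFactor π lam + γ) / (topoFactor π lam + m * n * γ)) ≤ K * T ∧
      (T : ℝ) ≤ K *
        (√(m * n) / γ * √((topoFactor π lam + γ) / (topoFactor π lam + m * n * γ))) ∧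
      (γ ≤ topoFactor π lam →
        1 / γ * √(m * n / (1 + m * n * γ / topoFactor π lam)) ≤ K * T ∧
        (T : ℝ) ≤ K * (1 / γ * √(m * n / (1 + m * n * γ / topoFactor π lam)))) ∧
      ExcessRiskAtMost.{u} n G L r W P (fun _ => γ) T
        (K * (1 / √(m * n) + √(γ / topoFactor π lam) + γ / topoFactor π lam + γ)) := by
  have hK1 := excessConst_nonneg (r := r) (W := W) hG hL (hC.nonneg hm)
  set K1 := excessConst G L r W C with hK1def
  have hκ := topoFactor_pos (lam := lam) hm hπ hl1
  set κ := topoFactor π lam with hκdef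
  have hN1 : (1 : ℝ) ≤ m * n := by
    have : 1 ≤ m * n := Nat.mul_pos hm hn
    exact_mod_cast this
  set N : ℝ := m * n with hN
  have hN0 : 0 < N := by linarith
  obtain ⟨ha1, ha2, ha3, ha4⟩ := constStep_bounds hN1 hκ hγ
  set a := √N * √((κ + γ) / (κ + N * γ)) with ha
  have hLinv : 0 < 1 / L := by positivity
  have e4 : 4 / L = 4 * (1 / L) := by ring
  have e12 : 12 / L = 12 * (1 / L) := by ring
  have e2 : 2 / L = 2 * (1 / L) := by ring
  set ℓ := 1 / L with hℓ
  have hK1ℓ : 0 ≤ K1 * ℓ := mul_nonneg hK1 hLinv.le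
  have hKge : 2 + 4 * ℓ ≤ K := by rw [hK, e12, e4]; nlinarith
  have hKge1 : 1 ≤ K := by linarith
  have hX : √N / γ * √((κ + γ) / (κ + N * γ)) = a / γ := by rw [ha]; ring
  rw [hX]
  set X := a / γ with hXdef
  have hXγ : X * γ = a := div_mul_cancel₀ a hγ.ne'
  have hXpos : 0 < X := div_pos (by linarith) hγ
  -- The unit lost in rounding `X` up is a multiple of `X`, because `a ≥ 1` and `γ ≤ 2 / L`.
  have h1X : 1 ≤ 2 * ℓ * X := by
    calc (1 : ℝ) ≤ a := ha1
      _ = γ * X := by rw [mul_comm, hXγ]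
      _ ≤ 2 / L * X := mul_le_mul_of_nonneg_right hγL hXpos.le
      _ = _ := by rw [e2]
  have hTlo : X ≤ (⌈X⌉₊ : ℝ) := Nat.le_ceil X
  have hThi : (⌈X⌉₊ : ℝ) ≤ (1 + 2 * ℓ) * X := by
    have := (Nat.ceil_lt_add_one hXpos.le).le
    linarith
  have hTpos : 0 < ⌈X⌉₊ := Nat.ceil_pos.mpr hXpos
  set T := ⌈X⌉₊ with hT
  have hTR : (0 : ℝ) < T := by exact_mod_cast hTpos
  refine ⟨T, hTpos, ?_, ?_, fun hγκ => ?_, ?_⟩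
  · exact hTlo.trans (le_mul_of_one_le_left hTR.le hKge1)
  · exact hThi.trans (mul_le_mul_of_nonneg_right (by linarith) hXpos.le)
  -- `Y` is `X` with `κ + γ` replaced by `κ`; for `γ ≤ κ` these differ by a factor at most two.
  · set Y := 1 / γ * √(N / (1 + N * γ / κ)) with hY
    have hYX1 : Y ≤ X := by
      rw [hY, hXdef, ha, ← Real.sqrt_mul hN0.le, one_div_mul_eq_div]
      refine div_le_div_of_nonneg_right (Real.sqrt_le_sqrt ?_) hγ.le
      have : 1 + N * γ / κ = (κ + N * γ) / κ := by field_simp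
      rw [this, div_div_eq_mul_div, ← mul_div_assoc]
      exact div_le_div_of_nonneg_right (by nlinarith) (by positivity)
    have hYX2 : X ≤ 2 * Y := by
      have hY2 : 2 * Y = 2 * √(N / (1 + N * γ / κ)) / γ := by rw [hY]; ring
      rw [hY2, hXdef, ha, ← Real.sqrt_mul hN0.le]
      refine div_le_div_of_nonneg_right ?_ hγ.le
      refine Real.sqrt_le_iff.mpr ⟨by positivity, ?_⟩
      rw [mul_pow, Real.sq_sqrt (by positivity)]
      have : 1 + N * γ / κ = (κ + N * γ) / κ := by field_simp
      rw [this, div_div_eq_mul_div, ← mul_div_assoc, ← mul_div_assoc]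
      exact div_le_div_of_nonneg_right (by nlinarith) (by positivity)
    refine ⟨(hYX1.trans hTlo).trans (le_mul_of_one_le_left hTR.le hKge1), hThi.trans ?_⟩
    calc (1 + 2 * ℓ) * X ≤ (1 + 2 * ℓ) * (2 * Y) := mul_le_mul_of_nonneg_left hYX2 (by positivity)
      _ = (2 + 4 * ℓ) * Y := by ring
      _ ≤ K * Y := mul_le_mul_of_nonneg_right hKge (by positivity)
  · refine excessRiskAtMost_of_le hm hn hG hL hP hs hπ hl hl1 hC (fun _ => hγ) hγL
      antitone_const hTpos fun s hs1 => ?_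
    rw [sum_Ico_const, ← hK1def, ← hκdef, ← hN]
    simp only [Finset.sum_const, Finset.card_range, nsmul_eq_mul]
    set M : ℝ := ((s + T : ℕ) : ℝ) with hM
    -- Here `s ≤ 1 ≤ T`: a start at round `1` at most doubles the number of rounds.
    have hM2 : M ≤ 2 * T := by
      have : s + T ≤ 2 * T := by omega
      rw [hM]; exact_mod_cast this
    set y := (T : ℝ) * γ with hy
    have hya : a ≤ y := by rw [← hXγ]; exact mul_le_mul_of_nonneg_right hTlo hγ.le
    have hyc : y ≤ (1 + 2 * ℓ) * a := by
      rw [← hXγ, ← mul_assoc]; exact mul_le_mul_of_nonneg_right hThi hγ.le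
    have hMγ : M * γ ≤ 2 * y :=
      (mul_le_mul_of_nonneg_right hM2 hγ.le).trans_eq (by rw [hy]; ring)
    have hsum := constStep_sum_le (M := M) hN0 hκ hγ hLinv ha1 ha2 ha3 ha4 hya hyc hMγ
    calc K1 * _ ≤ K1 * ((8 + 12 * ℓ) * (1 / √N + √(γ / κ) + γ / κ + γ)) :=
          mul_le_mul_of_nonneg_left hsum hK1
      _ = (K1 * (8 + 12 * ℓ)) * (1 / √N + √(γ / κ) + γ / κ + γ) := by ring
      _ ≤ K * (1 / √N + √(γ / κ) + γ / κ + γ) := by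
          refine mul_le_mul_of_nonneg_right ?_ (by positivity)
          rw [hK, e12, e4]
          linarith

lemma exists_stopping_time_diminishing (hm : 0 < m) (hn : 0 < n) (hG : 0 ≤ G) (hL : 0 < L)
    (hP : ∀ i j, 0 ≤ P i j) (hs : ∀ j, ∑ i, P i j = 1)
    (hπ : IsPerronVector P π) (hl : 0 ≤ lam) (hl1 : lam < 1) (hC : IsMixingConstant P π lam C)
    (hK : K = excessConst G L r W C * (8 + 12 / L) + (2 + 4 / L))
    {v : ℝ} (hv : 0 < v) (hvL : v ≤ 2 / L) :
    ∃ T : ℕ, 0 < T ∧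
      Real.exp (√(m * n) / v * √(1 + v ^ 2 / topoFactor π lam)) ≤ K * T ∧
      (T : ℝ) ≤ K * Real.exp (√(m * n) / v * √(1 + v ^ 2 / topoFactor π lam)) ∧
      ExcessRiskAtMost.{u} n G L r W P (fun t => v / (t + 1)) T
        (K * (1 / √(m * n) + v / topoFactor π lam + v / √(m * n * topoFactor π lam) + v ^ 2)) := by
  have hK1 := excessConst_nonneg (r := r) (W := W) hG hL (hC.nonneg hm)
  set K1 := excessConst G L r W C with hK1def
  have hκ := topoFactor_pos (lam := lam) hm hπ hl1
  set κ := topoFactor π lam with hκdef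
  have hN1 : (1 : ℝ) ≤ m * n := by
    have : 1 ≤ m * n := Nat.mul_pos hm hn
    exact_mod_cast this
  set N : ℝ := m * n with hN
  have hN0 : 0 < N := by linarith
  have hLinv : 0 < 1 / L := by positivity
  have e4 : 4 / L = 4 * (1 / L) := by ring
  have e12 : 12 / L = 12 * (1 / L) := by ring
  have e2 : 2 / L = 2 * (1 / L) := by ring
  set ℓ := 1 / L with hℓ
  have hK1ℓ : 0 ≤ K1 * ℓ := mul_nonneg hK1 hLinv.le
  have hKge : 2 ≤ K := by rw [hK, e12, e4]; nlinarith
  set R := √N with hR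
  have hR1 : 1 ≤ R := Real.one_le_sqrt.mpr hN1
  have hRR : R * R = N := Real.mul_self_sqrt hN0.le
  set S := √(1 + v ^ 2 / κ) with hS
  have hS1 : 1 ≤ S := Real.one_le_sqrt.mpr (le_add_of_nonneg_right (by positivity))
  set A := R / v * S with hA
  have hvA : v * A = R * S := by rw [hA]; field_simp
  have hApos : 0 < A := by positivity
  have hA1 : 1 ≤ 2 * ℓ * A := by
    calc (1 : ℝ) ≤ R * S := by nlinarith
      _ = v * A := hvA.symm
      _ ≤ 2 / L * A := mul_le_mul_of_nonneg_right hvL hApos.le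
      _ = _ := by rw [e2]
  have hE1 : 1 ≤ Real.exp A := Real.one_le_exp hApos.le
  have hTlo : Real.exp A ≤ (⌈Real.exp A⌉₊ : ℝ) := Nat.le_ceil _
  have hThi : (⌈Real.exp A⌉₊ : ℝ) ≤ 2 * Real.exp A := by
    have := (Nat.ceil_lt_add_one (Real.exp_pos A).le).le
    linarith
  have hTpos : 0 < ⌈Real.exp A⌉₊ := Nat.ceil_pos.mpr (Real.exp_pos A)
  set T := ⌈Real.exp A⌉₊ with hT
  have hTR : (0 : ℝ) < T := by exact_mod_cast hTpos
  refine ⟨T, hTpos, ?_, ?_, ?_⟩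
  · exact hTlo.trans (le_mul_of_one_le_left hTR.le (by linarith))
  · exact hThi.trans (mul_le_mul_of_nonneg_right hKge (Real.exp_pos A).le)
  · have hanti : Antitone (fun t : ℕ => v / ((t : ℝ) + 1)) := fun s t hst => by
      have : (s : ℝ) ≤ t := by exact_mod_cast hst
      exact div_le_div_of_nonneg_left hv.le (by positivity) (by linarith)
    refine excessRiskAtMost_of_le hm hn hG hL hP hs hπ hl hl1 hC (fun t => by positivity)
      (by simpa using hvL) hanti hTpos fun s hs1 => ?_
    rw [← hK1def, ← hκdef, ← hN]
    have es : ∀ I : Finset ℕ, ∑ t ∈ I, v / ((t : ℝ) + 1) = v * ∑ t ∈ I, 1 / ((t : ℝ) + 1) := by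
      intro I
      rw [Finset.mul_sum]
      exact Finset.sum_congr rfl fun t _ => by ring
    have es2 : ∑ t ∈ Finset.range (s + T), (v / ((t : ℝ) + 1)) ^ 2 ≤ 2 * v ^ 2 := by
      have : ∑ t ∈ Finset.range (s + T), (v / ((t : ℝ) + 1)) ^ 2 =
          v ^ 2 * ∑ t ∈ Finset.range (s + T), (1 / ((t : ℝ) + 1)) ^ 2 := by
        rw [Finset.mul_sum]
        exact Finset.sum_congr rfl fun t _ => by ring
      rw [this]
      have := sum_inv_sq_le_two (s + T)
      nlinarith [sq_nonneg v]
    have h0 : v / (((0 : ℕ) : ℝ) + 1) = v := by simp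
    have htot : v * A / 2 ≤ ∑ t ∈ Finset.Ico s (s + T), v / ((t : ℝ) + 1) := by
      rw [es]
      have h1 := half_le_log_of_exp_le hTlo (Nat.cast_nonneg s) (by exact_mod_cast hs1)
      have h2 := log_le_sum_inv s T
      nlinarith
    -- `s + T ≤ 2 T ≤ 4 exp A`, and `1 + log 4 ≤ 4`.
    have hlog : ∑ t ∈ Finset.range (s + T), v / ((t : ℝ) + 1) ≤ v * (4 + A) := by
      rw [es]
      refine mul_le_mul_of_nonneg_left ((sum_inv_le_one_add_log (s + T)).trans ?_) hv.le
      have h1 : ((s + T : ℕ) : ℝ) ≤ 4 * Real.exp A := by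
        have : s + T ≤ 2 * T := by omega
        have : ((s + T : ℕ) : ℝ) ≤ 2 * T := by exact_mod_cast this
        linarith
      have h2 : Real.log ((s + T : ℕ) : ℝ) ≤ Real.log (4 * Real.exp A) :=
        Real.log_le_log (by exact_mod_cast (by omega : 0 < s + T)) h1
      rw [Real.log_mul (by norm_num) (Real.exp_pos A).ne', Real.log_exp] at h2
      have h3 := Real.log_le_sub_one_of_pos (show (0 : ℝ) < 4 by norm_num)
      linarith
    rw [h0]
    set S2 := ∑ t ∈ Finset.range (s + T), (v / ((t : ℝ) + 1)) ^ 2 with hS2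
    have hS2nn : 0 ≤ S2 := Finset.sum_nonneg fun t _ => sq_nonneg _
    have hsum := diminishingStep_sum_le hN1 hκ hv hLinv (hvL.trans_eq e2) hApos hA1 hvA htot
      hS2nn es2 hlog
    calc K1 * _ ≤ K1 * ((8 + 12 * ℓ) * (1 / √N + v / κ + v / √(N * κ) + v ^ 2)) :=
          mul_le_mul_of_nonneg_left hsum hK1
      _ = (K1 * (8 + 12 * ℓ)) * (1 / √N + v / κ + v / √(N * κ) + v ^ 2) := by ring
      _ ≤ K * (1 / √N + v / κ + v / √(N * κ) + v ^ 2) := by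
          refine mul_le_mul_of_nonneg_right ?_ (by positivity)
          rw [hK, e12, e4]
          linarith

end EarlyStopping

end

theorem mainTheorem6 :
    -- the stationary distribution, the spectral gap and the mixing constant exist
    (∀ (m : ℕ), 0 < m → ∀ P : Matrix (Fin m) (Fin m) ℝ, P.IsPrimitive → (∀ j, ∑ i, P i j = 1) →
      (∃! π : Fin m → ℝ, IsPerronVector P π) ∧ 0 ≤ slem P ∧ slem P < 1 ∧
      ∀ π : Fin m → ℝ, IsPerronVector P π →
        (∀ lam : ℝ, slem P < lam → lam < 1 → ∃ C : ℝ, IsMixingConstant P π lam C) ∧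
        (IsDiagonalizable P → ∃ C : ℝ, IsMixingConstant P π (slem P) C)) ∧
    -- the excess risk at the early-stopping time
    (∀ (G L r W C : ℝ), 0 ≤ G → 0 < L → 0 < r →
      ∃ K : ℝ, 0 < K ∧
        ∀ (m n : ℕ), 0 < m → 0 < n →
        ∀ P : Matrix (Fin m) (Fin m) ℝ, P.IsPrimitive → (∀ j, ∑ i, P i j = 1) →
        ∀ π : Fin m → ℝ, IsPerronVector P π →
        ∀ lam : ℝ, 0 ≤ lam → lam < 1 → IsMixingConstant P π lam C →
          -- constant step sizes
          (∀ γ : ℝ, 0 < γ → γ ≤ 2 / L →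
            ∃ T : ℕ, 0 < T ∧
              Real.sqrt (m * n) / γ *
                  Real.sqrt ((topoFactor π lam + γ) / (topoFactor π lam + m * n * γ)) ≤ K * T ∧
              (T : ℝ) ≤ K * (Real.sqrt (m * n) / γ *
                  Real.sqrt ((topoFactor π lam + γ) / (topoFactor π lam + m * n * γ))) ∧
              (γ ≤ topoFactor π lam →
                1 / γ * Real.sqrt (m * n / (1 + m * n * γ / topoFactor π lam)) ≤ K * T ∧
                (T : ℝ) ≤ K *
                  (1 / γ * Real.sqrt (m * n / (1 + m * n * γ / topoFactor π lam)))) ∧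
              ExcessRiskAtMost.{u} n G L r W P (fun _ => γ) T
                (K * (1 / Real.sqrt (m * n) + Real.sqrt (γ / topoFactor π lam)
                  + γ / topoFactor π lam + γ))) ∧
          -- diminishing step sizes
          (∀ v : ℝ, 0 < v → v ≤ 2 / L →
            ∃ T : ℕ, 0 < T ∧
              Real.exp (Real.sqrt (m * n) / v * Real.sqrt (1 + v ^ 2 / topoFactor π lam))
                ≤ K * T ∧
              (T : ℝ) ≤ K *
                Real.exp (Real.sqrt (m * n) / v * Real.sqrt (1 + v ^ 2 / topoFactor π lam)) ∧
              ExcessRiskAtMost.{u} n G L r W P (fun t => v / (t + 1)) T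
                (K * (1 / Real.sqrt (m * n) + v / topoFactor π lam
                  + v / Real.sqrt (m * n * topoFactor π lam) + v ^ 2)))) := by
  refine ⟨fun m hm P hP hs => ?_, fun G L r W C hG hL hr => ?_⟩
  · obtain ⟨π, hπ⟩ := exists_isPerronVector hm hP hs
    exact ⟨⟨π, hπ, fun ρ hρ => hρ.unique hm hP hs hπ⟩, slem_nonneg P, slem_lt_one hm hP hs,
      fun ρ hρ => ⟨fun lam h _ => exists_isMixingConstant hm hP hs hρ h,
        exists_isMixingConstant_slem hm hP hs hρ⟩⟩
  · rcases lt_or_ge C 0 with hC0 | hC0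
    -- A negative `C` is a mixing constant of no matrix.
    · exact ⟨1, one_pos, fun m n hm hn P hP hs π hπ lam hl hl1 hC =>
        absurd (hC.nonneg hm) (not_le.mpr hC0)⟩
    have hK1 := excessConst_nonneg (r := r) (W := W) hG hL hC0
    -- The first summand serves the risk bounds. The second serves the two-sided bounds on `T`:
    -- rounding costs `1 + 2 / L` for constant steps, doubled in the form valid for `γ ≤ δ (1 - λ)`,
    -- and `2` for diminishing steps.
    exact ⟨excessConst G L r W C * (8 + 12 / L) + (2 + 4 / L), by positivity,
      fun m n hm hn P hP hs π hπ lam hl hl1 hC =>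
        ⟨fun γ hγ hγL => exists_stopping_time_const hm hn hG hL hP.nonneg hs hπ hl hl1 hC rfl
          hγ hγL,
        fun v hv hvL => exists_stopping_time_diminishing hm hn hG hL hP.nonneg hs hπ hl hl1 hC rfl
          hv hvL⟩⟩
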